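/- **Setting.** Let $N\ge 2$ be an integer, $\zeta_N=e^{2\pi i/N}$, and let $\chi_N$ be a Dirichlet character of modulus $N$ (not necessarily primitive). For $1\le k\le N$ and $y\in\mathbb C\setminus\mathbb R$ put $q=e^{2\pi i y}$ and $$f_{k,N}(y)=\log(\zeta_N^k;q)_\infty,\qquad \mathfrak f(y)=\sum_{k=1}^{N}\chi_N(k)\,f_{k,N}(y),$$ where $\log(x;q)_\infty=\sum_{n\ge 0}\log(1-xq^n)$ (principal logarithms) for $|q|<1$, that is $\operatorname{Im}y>0$, and $(x;q)_\infty$ is extended to $|q|>1$, that is $\operatorname{Im}y<0$, by $(x;q)_\infty=1/(xq^{-1};q^{-1})_\infty$, so that $\log(x;q)_\infty=-\sum_{n\ge 1}\log(1-xq^{-n})$. (The term $k=N$ is absent because $\chi_N(N)=0$.) For a formal Laurent series $\varphi(y)=\sum_{m\ge m_0}c_m y^m$, the Borel transform of its part with positive exponents is $\mathcal B(\zeta)=\sum_{n\ge 0}\frac{c_{n+1}}{n!}\zeta^n$ (required to have positive radius of convergence), and its Borel–Laplace sum at angle $\theta$ is $$s_\theta(\varphi)(y)=\sum_{m_0\le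 m\le 0}c_m y^m+\int_{e^{i\theta}\mathbb R_{\ge 0}}e^{-\zeta/y}\,\mathcal B(\zeta)\,d\zeta,\qquad \operatorname{Re}(e^{-i\theta}y)>0,$$ where $\mathcal B$ is continued analytically along the ray and the integral converges absolutely. The median resummation at angle $\theta$ is $\mathcal S^{\rm med}_\theta\varphi(y)=\tfrac12\big(s_{\theta+\epsilon}(\varphi)(y)+s_{\theta-\epsilon}(\varphi)(y)\big)$ for all sufficiently small $\epsilon>0$ (depending on $y$), each of the two lateral sums being independent of such $\epsilon$. **Theorem.** The function $\mathfrak f$ has a unique asymptotic expansion $\tilde{\mathfrak f}$ in formal Laurent series as $y\to 0$ with $\operatorname{Im}y>0$, and $\tilde{\mathfrak f}$ is also its unique asymptotic expansion as $y\to0$ with $\operatorname{Im}y<0$ (both along closed sectors whose punctured part lies in the respective open half-plane). The median resummation $\mathcal S^{\rm med}_{\pi/2}\tilde{\mathfrak f}(y)$ exists for all $y$ with $\operatorname{Im}y>0$, and $\mathcal S^{\rm med}_{-\pi/2}\tilde{\mathfrak f}(y)$ exists for all $y$ with $\operatorname{Im}y<0$. Moreover, $$\mathcal S^{\rm med}_{\pi/2}\tilde{\mathfrak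 f}(y)=\mathfrak f(y)\ \text{ for all } y \text{ with } \operatorname{Im}y>0\iff\chi_N\text{ is odd, i.e. }\chi_N(-1)=-1,$$ and $$\mathcal S^{\rm med}_{-\pi/2}\tilde{\mathfrak f}(y)=\mathfrak f(y)\ \text{ for all } y \text{ with } \operatorname{Im}y<0\iff\chi_N\text{ is odd}.$$ -/

import Mathlib

open Complex Filter Topology Asymptotics MeasureTheory

noncomputable section

/-- The logarithm `log (x; q)_∞ = ∑_{n ≥ 0} log (1 - x q ^ n)` of the infinite `q`-Pochhammer symbol
for `|q| < 1` and `|x| ≤ 1`, with the principal logarithm in every term; this is the branch which is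
continuous in `x` and vanishes at `x = 0`.  For `|q| > 1` the symbol is extended by the usual
relation `(x; q)_∞ = 1 / (x q⁻¹; q⁻¹)_∞`.  (The case `|q| = 1` is not used.) -/
def logQPochhammer (x q : ℂ) : ℂ :=
  if ‖q‖ < 1 then ∑' n : ℕ, Complex.log (1 - x * q ^ n)
  else -∑' n : ℕ, Complex.log (1 - x * (q⁻¹) ^ (n + 1))

/-- `f_{k,N}(y) = log (ζ_N ^ k; q)_∞`, with `ζ_N = exp (2πi/N)` and `q = exp (2πi y)`. -/
def fkN (k N : ℕ) (y : ℂ) : ℂ :=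
  logQPochhammer (Complex.exp (2 * Real.pi * I / N) ^ k) (Complex.exp (2 * Real.pi * I * y))

/-- `𝔣(y) = ∑_{k = 1}^{N} χ(k) f_{k,N}(y)`. -/
def weightedF {N : ℕ} (χ : DirichletCharacter ℂ N) (y : ℂ) : ℂ :=
  ∑ k ∈ Finset.Icc 1 N, χ (k : ZMod N) * fkN k N y

/-- The formal Laurent series `φ` is an asymptotic expansion of `f` as `y → 0` in the set `S`:
for every `n`, `f y = ∑_{m < n} φ_m y ^ m + O(y ^ n)`.  (Here `φ_m = 0` for `m < φ.order`.) -/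
def HasAsymptoticExpansionWithin (f : ℂ → ℂ) (S : Set ℂ) (φ : LaurentSeries ℂ) : Prop :=
  ∀ n : ℤ, (fun y : ℂ => f y - ∑ m ∈ Finset.Ico φ.order n, φ.coeff m * y ^ m)
    =O[𝓝[S] 0] (fun y : ℂ => y ^ n)

/-- Asymptotic expansion as `y → 0` with `Im y > 0`, in the usual sectorial sense: along every closed
sector with vertex `0` whose punctured part lies in the upper half-plane. -/
def HasAsymptoticExpansionUpper (f : ℂ → ℂ) (φ : LaurentSeries ℂ) : Prop :=
  ∀ M : ℝ, HasAsymptoticExpansionWithin f {y : ℂ | 0 < y.im ∧ |y.re| ≤ M * y.im} φ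

/-- Asymptotic expansion as `y → 0` with `Im y < 0`, in the same sectorial sense. -/
def HasAsymptoticExpansionLower (f : ℂ → ℂ) (φ : LaurentSeries ℂ) : Prop :=
  ∀ M : ℝ, HasAsymptoticExpansionWithin f {y : ℂ | y.im < 0 ∧ |y.re| ≤ M * (-y.im)} φ

/-- `B` is, on the open set `U` which is star-shaped around `0`, the analytic continuation of the
Borel transform `∑_{n ≥ 0} (a_n / n!) ζ ^ n` of the formal power series `∑_{n ≥ 0} a_n y ^ (n + 1)`;
in particular the Borel transform has a positive radius of convergence. -/
structure IsBorelContinuation (a : ℕ → ℂ) (U : Set ℂ) (B : ℂ → ℂ) : Prop where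
  isOpen : IsOpen U
  starConvex : StarConvex ℝ 0 U
  differentiableOn : DifferentiableOn ℂ B U
  hasSum : ∀ᶠ ζ in 𝓝 (0 : ℂ), HasSum (fun n : ℕ => a n / (n.factorial : ℂ) * ζ ^ n) (B ζ)

/-- `v` is the value at `y` of the Borel-Laplace sum of the formal power series
`∑_{n ≥ 0} a_n y ^ (n + 1)` along the ray `ζ = t e ^ {iθ}`, `t ≥ 0`:
the Borel transform continues analytically along the ray, and
`v = ∫ exp (-ζ / y) B(ζ) dζ` over the ray, the integral being absolutely convergent. -/
def HasLaplaceSum (a : ℕ → ℂ) (θ : ℝ) (y v : ℂ) : Prop :=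
  0 < (Complex.exp (-(θ * I)) * y).re ∧
  ∃ (U : Set ℂ) (B : ℂ → ℂ), IsBorelContinuation a U B ∧
    (∀ t : ℝ, 0 ≤ t → (t : ℂ) * Complex.exp (θ * I) ∈ U) ∧
    IntegrableOn (fun t : ℝ => Complex.exp (-(t * Complex.exp (θ * I)) / y) *
      B (t * Complex.exp (θ * I)) * Complex.exp (θ * I)) (Set.Ioi 0) ∧
    ∫ t in Set.Ioi (0 : ℝ), Complex.exp (-(t * Complex.exp (θ * I)) / y) *
      B (t * Complex.exp (θ * I)) * Complex.exp (θ * I) = v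

/-- Borel-Laplace sum at angle `θ` of a formal Laurent series `φ`: the finitely many terms `φ_m y ^ m`
with `m ≤ 0` are kept as they are, and the part `∑_{n ≥ 0} φ_{n + 1} y ^ (n + 1)` is summed by the
Laplace transform of its Borel transform. -/
def HasBorelLaplaceSum (φ : LaurentSeries ℂ) (θ : ℝ) (y v : ℂ) : Prop :=
  HasLaplaceSum (fun n : ℕ => φ.coeff ((n : ℤ) + 1)) θ y
    (v - ∑ m ∈ Finset.Icc φ.order 0, φ.coeff m * y ^ m)

/-- `v` is the value at `y` of the median resummation of `φ` at angle `θ`: the average of the two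
lateral Borel-Laplace sums, at the angles `θ + ε` and `θ - ε` with `ε > 0` small. -/
def HasMedianSum (φ : LaurentSeries ℂ) (θ : ℝ) (y v : ℂ) : Prop :=
  ∃ vp vm : ℂ,
    (∀ᶠ ε in 𝓝[>] (0 : ℝ), HasBorelLaplaceSum φ (θ + ε) y vp) ∧
    (∀ᶠ ε in 𝓝[>] (0 : ℝ), HasBorelLaplaceSum φ (θ - ε) y vm) ∧
    v = (vp + vm) / 2

end

/-! Let x ≠ 1 be an N-th root of unity, B_x = `borelSeries x` and L_x = `laplaceSeries x`, the
Laplace transform of B_x along any admissible ray in the right half-plane. B_x can be singular only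
at the points l·w with e^w = x, all on the imaginary axis and at distance at least 2π/N from 0.
Writing log (x;q)_∞ as a Lambert series and q^m/(1 - q^m) through the partial fractions of the
cotangent gives, in both half-planes, log (x;q)_∞ = ½ log(1-x) - (i/2π) Li₂(x)/y + (i/2π)(L_x(y) -
L_x(-y)) (`logQPochhammer_exp`). Watson's lemma for L_x (`exists_norm_laplaceSeries_sub_le`),
applied at y and at -y, turns this into one Laurent expansion a/y + b + ..., valid from above and
from below, whose Borel transform is the even function (i/2π) ∑ χ(k) (B_x(ζ) + B_x(-ζ)) with x =
ζ_N^k.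

To the right of the imaginary axis B_x(-ζ) = -π²/6 - B_{1/x}(ζ) (`borelSeries_neg_ray`). Hence the
lateral sum on the right is a/y + b + E(y) with E(y) = (i/2π) ∑ χ(k) (L_x(y) - L_{1/x}(y) - π² y/6),
and by evenness the one on the left is a/y + b - E(-y). The median sum is a/y + b + (E(y) -
E(-y))/2. The substitution k ↦ N - k exchanges x and 1/x at the cost of χ(-1) (`charSum_inv`), so
the L-terms carry the factor (1 - χ(-1))/2. For odd χ this factor is 1, the linear term vanishes,
and the formula for 𝔣 is recovered.

For even χ only a Laurent polynomial a/y + b + cy survives, and 𝔣 is not one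
(`weightedF_ne_laurent_polynomial`): 1-periodicity forces a = c = 0, then a Lambert series in q is
constant, so all its coefficients vanish, which a Vandermonde argument excludes. The lower
half-plane reduces to the upper one by `weightedF_neg`. -/

/-- The generating function `x / (e ^ w - x) = ∑_{m ≥ 1} x ^ m e ^ {-mw}`. -/
noncomputable def expKernel (x w : ℂ) : ℂ := x / (cexp w - x)

/-- The series `∑_{l ≥ 1} l⁻² x / (e ^ {ζ / l} - x)`. -/
noncomputable def borelSeries (x ζ : ℂ) : ℂ := ∑' l : ℕ, expKernel x (ζ / (l + 1)) / (l + 1) ^ 2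

/-- The general term, for the indices `l + 1` and `m`, of the double series for `laplaceSeries`. -/
noncomputable def laplaceTerm (y : ℂ) (l m : ℕ) : ℂ :=
  y ^ 2 / ((l + 1) * (l + 1 + m * y) * (l + 1 + (m + 1) * y))

/-- The Laplace transform of `borelSeries x`, as an absolutely convergent double series. -/
noncomputable def laplaceSeries (x y : ℂ) : ℂ :=
  x / (1 - x) * (y * (Real.pi ^ 2 / 6) - ∑' p : ℕ × ℕ, x ^ p.2 * laplaceTerm y p.1 p.2)

/-! ### The kernel x / (e^w - x) and its Laplace transform along a ray. -/

lemma exp_ne_of_re_ne_zero {x w : ℂ} (hx : ‖x‖ = 1) (hw : w.re ≠ 0) : cexp w ≠ x := by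
  rintro rfl
  rw [norm_exp, Real.exp_eq_one_iff] at hx
  exact hw hx

lemma exp_ray_ne {x u : ℂ} (hx : ‖x‖ = 1) (hx1 : x ≠ 1) (hu : 0 < u.re) (t : ℝ) :
    cexp (t * u) ≠ x := by
  rcases eq_or_ne t 0 with rfl | ht
  · simpa using hx1.symm
  · exact exp_ne_of_re_ne_zero hx (by simp [ht, hu.ne'])

lemma continuous_expKernel_ray {x u : ℂ} (hx : ‖x‖ = 1) (hx1 : x ≠ 1) (hu : 0 < u.re) :
    Continuous fun t : ℝ => expKernel x (t * u) := by
  unfold expKernel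
  exact continuous_const.div (by fun_prop) fun t => sub_ne_zero.2 (exp_ray_ne hx hx1 hu t)

/-- Compactness handles the initial segment. Once Re w ≥ 1, the inequality 1 + s ≤ e^s gives |e^w| ≥
2, so the denominator has modulus at least 1. -/
lemma exists_norm_expKernel_ray_le {x u : ℂ} (hx : ‖x‖ = 1) (hx1 : x ≠ 1) (hu : 0 < u.re) :
    ∃ K : ℝ, ∀ t : ℝ, 0 ≤ t → ‖expKernel x (t * u)‖ ≤ K := by
  obtain ⟨K, hK⟩ := (isCompact_Icc (a := (0 : ℝ)) (b := 1 / u.re)).exists_bound_of_continuousOn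
    (continuous_expKernel_ray hx hx1 hu).continuousOn
  refine ⟨max K 1, fun t ht => ?_⟩
  rcases le_total t (1 / u.re) with h | h
  · exact (hK t ⟨ht, h⟩).trans (le_max_left _ _)
  · refine le_trans ?_ (le_max_right _ _)
    have h1 : 1 ≤ t * u.re := by rwa [div_le_iff₀ hu] at h
    have h2 : 2 ≤ ‖cexp (t * u)‖ := by
      rw [norm_exp]
      have : 1 + 1 ≤ Real.exp ((t * u).re) := by
        refine le_trans ?_ (Real.add_one_le_exp _)
        simpa using h1
      linarith
    have h3 := norm_sub_norm_le (cexp (t * u)) x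
    unfold expKernel
    rw [norm_div, hx]
    exact (div_le_one (by linarith)).2 (by linarith)

lemma integrableOn_pow_mul_exp_neg_mul {k : ℂ} (hk : 0 < k.re) (n : ℕ) :
    IntegrableOn (fun t : ℝ => (t : ℂ) ^ n * cexp (-(k * t))) (Set.Ioi 0) := by
  have h := integrableOn_rpow_mul_exp_neg_mul_rpow (p := 1) (s := n) (b := k.re)
    (by linarith [n.cast_nonneg (α := ℝ)]) one_pos hk
  refine Integrable.mono' h (by fun_prop) ?_
  filter_upwards [ae_restrict_mem measurableSet_Ioi] with t ht
  have ht' : (0 : ℝ) < t := ht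
  simp [norm_exp, abs_of_pos ht']

lemma integral_pow_mul_exp_neg_mul {k : ℂ} (hk : 0 < k.re) (n : ℕ) :
    ∫ t : ℝ in Set.Ioi 0, (t : ℂ) ^ n * cexp (-(k * t)) = n.factorial / k ^ (n + 1) := by
  have hk0 : k ≠ 0 := by rintro rfl; simp at hk
  have hd : ∀ t : ℝ, HasDerivAt (fun t : ℝ => cexp (-(k * t))) (-k * cexp (-(k * t))) t :=
    fun t => by
      have h := (((hasDerivAt_id (t : ℂ)).const_mul k).neg.cexp).comp_ofReal
      simpa [mul_comm] using h
  have hlim : ∀ n : ℕ, Tendsto (fun t : ℝ => (t : ℂ) ^ n * cexp (-(k * t))) atTop (𝓝 0) :=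
    fun n => by
      rw [tendsto_zero_iff_norm_tendsto_zero]
      refine (tendsto_rpow_mul_exp_neg_mul_atTop_nhds_zero n k.re hk).congr' ?_
      filter_upwards [eventually_gt_atTop 0] with t ht
      simp [norm_exp, abs_of_pos ht]
  induction n with
  | zero =>
    have h := integral_Ioi_of_hasDerivAt_of_tendsto' (a := 0)
      (f := fun t : ℝ => -(1 / k) * cexp (-(k * t))) (f' := fun t : ℝ => cexp (-(k * t))) (m := 0)
      (fun t _ => ((hd t).const_mul (-(1 / k))).congr_deriv (by field_simp))
      (by simpa using integrableOn_pow_mul_exp_neg_mul hk 0)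
      (by simpa using (hlim 0).const_mul (-(1 / k)))
    simpa using h
  | succ n ih =>
    have h := integral_Ioi_of_hasDerivAt_of_tendsto' (a := 0)
      (f := fun t : ℝ => -(1 / k) * ((t : ℂ) ^ (n + 1) * cexp (-(k * t))))
      (f' := fun t : ℝ => (t : ℂ) ^ (n + 1) * cexp (-(k * t)) -
        (n + 1) / k * ((t : ℂ) ^ n * cexp (-(k * t)))) (m := 0)
      (fun t _ => by
        have hp : HasDerivAt (fun t : ℝ => (t : ℂ) ^ (n + 1)) ((n + 1) * (t : ℂ) ^ n) t := by
          simpa using (hasDerivAt_pow (n + 1) (t : ℂ)).comp_ofReal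
        refine ((hp.mul (hd t)).const_mul (-(1 / k))).congr_deriv ?_
        field_simp
        ring)
      ((integrableOn_pow_mul_exp_neg_mul hk (n + 1)).sub
        ((integrableOn_pow_mul_exp_neg_mul hk n).const_mul _))
      (by simpa using (hlim (n + 1)).const_mul (-(1 / k)))
    rw [integral_sub (integrableOn_pow_mul_exp_neg_mul hk (n + 1))
        ((integrableOn_pow_mul_exp_neg_mul hk n).const_mul _), integral_const_mul, ih] at h
    simp only [ofReal_zero, ne_eq, Nat.add_eq_zero_iff, one_ne_zero, and_false, not_false_eq_true,
      zero_pow, zero_mul, mul_zero, sub_self, sub_eq_zero] at h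
    rw [h, Nat.factorial_succ]
    push_cast
    field_simp
    ring

lemma integral_exp_neg_mul {k : ℂ} (hk : 0 < k.re) :
    ∫ t : ℝ in Set.Ioi 0, cexp (-(k * t)) = 1 / k := by
  simpa using integral_pow_mul_exp_neg_mul hk 0

lemma integrableOn_exp_neg_mul {k : ℂ} (hk : 0 < k.re) :
    IntegrableOn (fun t : ℝ => cexp (-(k * t))) (Set.Ioi 0) := by
  simpa using integrableOn_pow_mul_exp_neg_mul hk 0

lemma norm_one_sub_exp_neg_le {w : ℂ} (hw : 0 ≤ w.re) : ‖1 - cexp (-w)‖ ≤ ‖w‖ := by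
  have h := (convex_halfSpace_re_le 0).norm_image_sub_le_of_norm_hasDerivWithin_le
    (f := cexp) (f' := cexp) (C := 1) (x := -w) (y := 0)
    (fun z _ => (hasDerivAt_exp z).hasDerivWithinAt)
    (fun z hz => by rw [norm_exp]; exact Real.exp_le_one_iff.2 hz) (by simpa using hw) (by simp)
  simpa using h

lemma summable_inv_add_mul_sq {a c : ℝ} (ha : 0 < a) (hc : 0 < c) :
    Summable fun m : ℕ => 1 / (a + m * c) ^ 2 := by
  -- The extra summand covers m = 0, where 1 / m² is 0 by convention.
  have h : Summable fun m : ℕ => (1 / c ^ 2 + 1 / a ^ 2) * (1 / (m : ℝ) ^ 2) +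
      if m = 0 then 1 / a ^ 2 else 0 :=
    ((Real.summable_one_div_nat_pow.2 one_lt_two).mul_left _).add
      (summable_of_ne_finset_zero (s := {0}) fun m hm => by simp_all)
  refine h.of_nonneg_of_le (fun m => by positivity) fun m => ?_
  rcases Nat.eq_zero_or_pos m with rfl | hm
  · simp
  · have hm' : (0 : ℝ) < m := by exact_mod_cast hm
    simp only [hm.ne', if_false, add_zero]
    calc 1 / (a + m * c) ^ 2 ≤ 1 / (m * c) ^ 2 := by gcongr; linarith
      _ = 1 / c ^ 2 * (1 / (m : ℝ) ^ 2) := by field_simp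
      _ ≤ _ := by gcongr; simp; positivity

/-- `x / (e ^ w - x)` as an absolutely convergent series, summed by parts. -/
lemma expKernel_eq_tsum {x w : ℂ} (hx : ‖x‖ = 1) (hx1 : x ≠ 1) (hw : 0 < w.re) :
    expKernel x w = x / (1 - x) *
      (1 - ∑' m : ℕ, x ^ m * ((1 - cexp (-w)) * cexp (-(m * w)))) := by
  have hlt : ‖x * cexp (-w)‖ < 1 := by
    rw [norm_mul, hx, one_mul, norm_exp]
    simpa using hw
  have h1 : ∑' m : ℕ, x ^ m * ((1 - cexp (-w)) * cexp (-(m * w))) =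
      (1 - cexp (-w)) * (1 - x * cexp (-w))⁻¹ := by
    rw [← tsum_geometric_of_norm_lt_one hlt, ← tsum_mul_left]
    refine tsum_congr fun m => ?_
    rw [mul_pow, ← Complex.exp_nat_mul]
    ring_nf
  have h2 : 1 - x * cexp (-w) ≠ 0 := by
    intro h
    rw [← sub_eq_zero.1 h] at hlt
    simp at hlt
  have h3 : cexp w - x ≠ 0 := sub_ne_zero.2 (exp_ne_of_re_ne_zero hx hw.ne')
  have h4 : 1 - x ≠ 0 := sub_ne_zero.2 hx1.symm
  have h5 : cexp w * cexp (-w) = 1 := by rw [← Complex.exp_add]; simp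
  rw [h1, expKernel]
  field_simp
  linear_combination (-(1 - x)) * x * h5

/-- Integrating ∑ x^m e^{-mw} term by term would produce terms of size 1/m, not absolutely summable.
The summed-by-parts form `expKernel_eq_tsum` replaces them by differences of size 1/m². -/
lemma laplace_expKernel {x u y : ℂ} (hx : ‖x‖ = 1) (hx1 : x ≠ 1) (hu : 0 < u.re)
    (huy : 0 < (u / y).re) {r : ℝ} (hr : 0 < r) :
    ∫ t : ℝ in Set.Ioi 0, cexp (-(t * u) / y) * expKernel x (t * u * r) * u =
      x / (1 - x) * (y - ∑' m : ℕ, x ^ m * (1 / (1 / y + m * r) - 1 / (1 / y + (m + 1) * r))) := by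
  have hy : y ≠ 0 := by rintro rfl; simp at huy
  have hu0 : u ≠ 0 := by rintro rfl; simp at hu
  set k : ℕ → ℂ := fun m => u / y + m * r * u with hk
  have hkre : ∀ m, (k m).re = (u / y).re + m * (r * u.re) := fun m => by
    simp [hk, mul_assoc]
  have hkpos : ∀ m, 0 < (k m).re := fun m => by rw [hkre]; positivity
  have hk' : ∀ m : ℕ, k (m + 1) = k m + r * u := fun m => by simp [hk]; ring
  set F : ℕ → ℝ → ℂ := fun m t => x ^ m * u * (cexp (-(k m * t)) - cexp (-(k (m + 1) * t))) with hF
  have hFint : ∀ m, Integrable (F m) (volume.restrict (Set.Ioi 0)) := fun m =>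
    ((integrableOn_exp_neg_mul (hkpos m)).sub (integrableOn_exp_neg_mul (hkpos (m + 1)))).const_mul _
  have hFval : ∀ m, ∫ t in Set.Ioi 0, F m t =
      x ^ m * (1 / (1 / y + m * r) - 1 / (1 / y + (m + 1) * r)) := fun m => by
    simp only [hF]
    rw [integral_const_mul, integral_sub (integrableOn_exp_neg_mul (hkpos m))
      (integrableOn_exp_neg_mul (hkpos (m + 1))), integral_exp_neg_mul (hkpos m),
      integral_exp_neg_mul (hkpos (m + 1))]
    have e1 : k m = u * (1 / y + m * r) := by simp only [hk]; ring
    have e2 : k (m + 1) = u * (1 / y + (m + 1) * r) := by simp only [hk]; push_cast; ring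
    rw [e1, e2, ← div_div, ← div_div, div_right_comm, div_right_comm 1 u, ← sub_div]
    field_simp
  have hFeq : ∀ m (t : ℝ), F m t = cexp (-(t * u) / y) * u *
      (x ^ m * ((1 - cexp (-(t * u * r))) * cexp (-(m * (t * u * r))))) := fun m t => by
    have e1 : cexp (-(k m * t)) = cexp (-(t * u) / y) * cexp (-(m * (t * u * r))) := by
      rw [← Complex.exp_add]; congr 1; simp only [hk]; ring
    have e2 : cexp (-(k (m + 1) * t)) =
        cexp (-(t * u) / y) * cexp (-(m * (t * u * r))) * cexp (-(t * u * r)) := by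
      rw [← Complex.exp_add, ← Complex.exp_add]; congr 1; rw [hk']; simp only [hk]; ring
    simp only [hF, e1, e2]; ring
  -- The bound |1 - e^{-w}| ≤ |w| contributes a factor t, so the integral is Γ(2) over the square of
  -- Re (k m), which is summable in m.
  have hFnorm : ∀ m, ∫ t in Set.Ioi 0, ‖F m t‖ ≤
      ‖u‖ ^ 2 * r * (1 / ((u / y).re + m * (r * u.re)) ^ 2) := fun m => by
    have hb : ∀ t ∈ Set.Ioi (0 : ℝ), ‖F m t‖ ≤
        ‖u‖ ^ 2 * r * (t ^ ((2 : ℝ) - 1) * Real.exp (-((k m).re * t))) := fun t ht => by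
      have ht' : (0 : ℝ) < t := ht
      have e : F m t = x ^ m * u * cexp (-(k m * t)) * (1 - cexp (-(t * u * r))) := by
        rw [hFeq]
        have e1 : cexp (-(k m * t)) = cexp (-(t * u) / y) * cexp (-(m * (t * u * r))) := by
          rw [← Complex.exp_add]; congr 1; simp only [hk]; ring
        rw [e1]; ring
      have hn := norm_one_sub_exp_neg_le (w := t * u * r) (by simp; positivity)
      rw [e, norm_mul, norm_mul, norm_mul, norm_pow, hx, one_pow, one_mul, norm_exp]
      have e3 : (-(k m * t)).re = -((k m).re * t) := by simp
      rw [e3]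
      calc _ ≤ ‖u‖ * Real.exp (-((k m).re * t)) * ‖(t : ℂ) * u * r‖ := by gcongr
        _ = _ := by
          rw [norm_mul, norm_mul, norm_real, norm_real, Real.norm_of_nonneg ht'.le,
            Real.norm_of_nonneg hr.le]
          norm_num
          ring
    have hi : IntegrableOn (fun t : ℝ => ‖u‖ ^ 2 * r *
        (t ^ ((2 : ℝ) - 1) * Real.exp (-((k m).re * t)))) (Set.Ioi 0) := by
      have := integrableOn_rpow_mul_exp_neg_mul_rpow (p := 1) (s := 2 - 1) (b := (k m).re)
        (by norm_num) one_pos (hkpos m)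
      simp only [Real.rpow_one] at this
      simp only [neg_mul] at this
      exact this.const_mul (‖u‖ ^ 2 * r)
    refine (setIntegral_mono_on (hFint m).norm hi measurableSet_Ioi hb).trans_eq ?_
    rw [integral_const_mul, Real.integral_rpow_mul_exp_neg_mul_Ioi (by norm_num) (hkpos m), hkre]
    simp
  have hsum : Summable fun m => ∫ t in Set.Ioi 0, ‖F m t‖ :=
    ((summable_inv_add_mul_sq huy (mul_pos hr hu)).mul_left _).of_nonneg_of_le
      (fun m => integral_nonneg fun t => norm_nonneg _) hFnorm
  have hH := hasSum_integral_of_summable_integral_norm hFint hsum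
  have hS : ∀ t ∈ Set.Ioi (0 : ℝ), ∑' m, F m t = cexp (-(t * u) / y) * u -
      (1 - x) / x * (cexp (-(t * u) / y) * expKernel x (t * u * r) * u) := fun t ht => by
    have ht' : (0 : ℝ) < t := ht
    have h4 : 1 - x ≠ 0 := sub_ne_zero.2 hx1.symm
    have hx0 : x ≠ 0 := by rintro rfl; simp at hx
    rw [expKernel_eq_tsum hx hx1 (w := t * u * r) (by simp; positivity)]
    simp_rw [hFeq]
    rw [tsum_mul_left]
    field_simp
    ring_nf
  have hS2 : ∀ t ∈ Set.Ioi (0 : ℝ), cexp (-(t * u) / y) * expKernel x (t * u * r) * u =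
      x / (1 - x) * (cexp (-(u / y * t)) * u - ∑' m, F m t) := fun t ht => by
    have h4 : 1 - x ≠ 0 := sub_ne_zero.2 hx1.symm
    have hx0 : x ≠ 0 := by rintro rfl; simp at hx
    rw [hS t ht]
    have e : -(u / y * t) = -(t * u) / y := by ring
    rw [e]
    field_simp
    ring
  have hTint : Integrable (fun t => ∑' m, F m t) (volume.restrict (Set.Ioi (0 : ℝ))) := by
    have hc : IntegrableOn (fun t : ℝ => cexp (-(t * u) / y) * u -
      (1 - x) / x * (cexp (-(t * u) / y) * expKernel x (t * u * r) * u)) (Set.Ioi 0) := by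
      obtain ⟨K, hK⟩ := exists_norm_expKernel_ray_le hx hx1 (u := u * r) (by simp; positivity)
      have hE : IntegrableOn (fun t : ℝ => cexp (-(t * u) / y)) (Set.Ioi 0) := by
        refine (integrableOn_exp_neg_mul huy).congr_fun (fun t _ => ?_) measurableSet_Ioi
        simp only
        congr 1; ring
      have hcont := continuous_expKernel_ray hx hx1 (u := u * r) (by simp; positivity)
      refine (hE.mul_const u).sub (((hE.mul_bdd (c := K) ?_ ?_).mul_const u).const_mul _)
      · simp_rw [mul_assoc]
        exact hcont.aestronglyMeasurable
      · filter_upwards [ae_restrict_mem measurableSet_Ioi] with t ht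
        rw [mul_assoc]
        exact hK t (le_of_lt ht)
    exact hc.congr_fun (fun t ht => (hS t ht).symm) measurableSet_Ioi
  rw [setIntegral_congr_fun measurableSet_Ioi hS2, integral_const_mul, integral_sub _ hTint,
    ← hH.tsum_eq, integral_mul_const, integral_exp_neg_mul huy]
  · simp_rw [hFval]
    congr 2
    field_simp
  · exact (integrableOn_exp_neg_mul huy).mul_const u

/-! ### The double series and the Laplace transform of `borelSeries`. -/

lemma summable_inv_succ_sq : Summable fun l : ℕ => 1 / ((l : ℝ) + 1) ^ 2 := by
  have h := (summable_nat_add_iff 1).2 (Real.summable_one_div_nat_pow.2 one_lt_two)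
  simpa using h

lemma hasSum_inv_succ_sq : HasSum (fun l : ℕ => 1 / ((l : ℂ) + 1) ^ 2) ((Real.pi : ℂ) ^ 2 / 6) := by
  have h := (hasSum_nat_add_iff' 1).2 hasSum_zeta_two
  simp only [Finset.range_one, Finset.sum_singleton, Nat.cast_zero, ne_eq, OfNat.ofNat_ne_zero,
    not_false_eq_true, zero_pow, div_zero, sub_zero, Nat.cast_add, Nat.cast_one] at h
  simpa using Complex.hasSum_ofReal.2 h

/-- After multiplication by u / y the two summands become (l + 1)(u / y) and m u, both with
nonnegative real part, so they cannot cancel. -/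
lemma exists_norm_linear_ge {u y : ℂ} (hu : 0 < u.re) (huy : 0 < (u / y).re) :
    ∃ δ : ℝ, 0 < δ ∧ ∀ l m : ℕ, δ * (l + 1 + m) ≤ ‖(l : ℂ) + 1 + m * y‖ := by
  have hy : y ≠ 0 := by rintro rfl; simp at huy
  have hu0 : u ≠ 0 := by rintro rfl; simp at hu
  have hn : 0 < ‖u / y‖ := norm_pos_iff.2 (div_ne_zero hu0 hy)
  refine ⟨min (u / y).re u.re / ‖u / y‖, div_pos (lt_min huy hu) hn, fun l m => ?_⟩
  rw [div_mul_eq_mul_div, div_le_iff₀ hn, ← norm_mul]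
  refine le_trans ?_ (Complex.re_le_norm _)
  have e : ((l : ℂ) + 1 + m * y) * (u / y) = ((l + 1 : ℝ) : ℂ) * (u / y) + ((m : ℝ) : ℂ) * u := by
    push_cast; field_simp
  rw [e, add_re, re_ofReal_mul, re_ofReal_mul, mul_add, mul_comm (l + 1 : ℝ), mul_comm (m : ℝ)]
  gcongr
  · exact min_le_left _ _
  · exact min_le_right _ _

/-- The denominator is at least a constant times (l+1)(l+1+m)². Splitting the square as the powers
1/2 and 3/2 bounds this below by (l+1)^{3/2} (m+1)^{3/2}, a product of two summable weights. -/
lemma summable_laplaceTerm {x u y : ℂ} (hx : ‖x‖ = 1) (hu : 0 < u.re) (huy : 0 < (u / y).re) :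
    Summable fun p : ℕ × ℕ => x ^ p.2 * laplaceTerm y p.1 p.2 := by
  obtain ⟨δ, hδ, h⟩ := exists_norm_linear_ge hu huy
  have hs : Summable fun l : ℕ => 1 / ((l : ℝ) + 1) ^ (3 / 2 : ℝ) := by
    have h := (summable_nat_add_iff 1).2
      (Real.summable_one_div_nat_rpow.2 (by norm_num : (1 : ℝ) < 3 / 2))
    simpa using h
  refine Summable.of_norm_bounded (g := fun p : ℕ × ℕ => ‖y‖ ^ 2 / δ ^ 2 *
    ((1 / ((p.1 : ℝ) + 1) ^ (3 / 2 : ℝ)) * (1 / ((p.2 : ℝ) + 1) ^ (3 / 2 : ℝ))))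
    ((hs.mul_of_nonneg hs (fun _ => by positivity) fun _ => by positivity).mul_left _) ?_
  rintro ⟨l, m⟩
  simp only [laplaceTerm, norm_mul, norm_pow, norm_div, hx, one_pow, one_mul]
  have h1 := h l m
  have h2 := h l (m + 1)
  push_cast at h2
  have h3 : ‖(l : ℂ) + 1‖ = l + 1 := by exact_mod_cast Complex.norm_natCast (l + 1)
  rw [h3, div_mul_div_comm, one_mul, div_mul_div_comm, mul_one]
  have hl : (0 : ℝ) < l + 1 := by positivity
  have hlm : (0 : ℝ) < l + 1 + m := by positivity
  refine div_le_div_of_nonneg_left (by positivity) (by positivity) ?_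
  calc δ ^ 2 * (((l : ℝ) + 1) ^ (3 / 2 : ℝ) * ((m : ℝ) + 1) ^ (3 / 2 : ℝ))
      = δ ^ 2 * ((l + 1) * ((l + 1 : ℝ) ^ (1 / 2 : ℝ) * ((m : ℝ) + 1) ^ (3 / 2 : ℝ))) := by
        rw [show (3 / 2 : ℝ) = 1 + 1 / 2 by norm_num, Real.rpow_add hl, Real.rpow_one]; ring
    _ ≤ δ ^ 2 * ((l + 1) *
          ((l + 1 + m : ℝ) ^ (1 / 2 : ℝ) * ((l : ℝ) + 1 + m) ^ (3 / 2 : ℝ))) := by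
        have hA : (l + 1 : ℝ) ≤ l + 1 + m := by linarith [m.cast_nonneg (α := ℝ)]
        have hB : (m + 1 : ℝ) ≤ l + 1 + m := by linarith [l.cast_nonneg (α := ℝ)]
        have hA' := Real.rpow_le_rpow (by positivity) hA (by norm_num : (0 : ℝ) ≤ 1 / 2)
        have hB' := Real.rpow_le_rpow (by positivity) hB (by norm_num : (0 : ℝ) ≤ 3 / 2)
        exact mul_le_mul_of_nonneg_left (mul_le_mul_of_nonneg_left
          (mul_le_mul hA' hB' (by positivity) (by positivity)) (by positivity)) (by positivity)
    _ = (l + 1) * (δ * (l + 1 + m)) * (δ * (l + 1 + m)) := by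
        rw [← Real.rpow_add hlm]; norm_num; ring
    _ ≤ _ := by
        gcongr
        exact le_trans (by gcongr; linarith) h2

lemma ray_div_succ (u : ℂ) (t : ℝ) (l : ℕ) :
    (t : ℂ) * u / (l + 1) = t * u * ((1 / (l + 1 : ℝ) : ℝ) : ℂ) := by
  push_cast; ring

/-- Dividing by l + 1 stays on the same ray, so one bound of the kernel along that ray serves every
l. -/
lemma exists_norm_borel_ray_term_le {x u : ℂ} (hx : ‖x‖ = 1) (hx1 : x ≠ 1) (hu : 0 < u.re) :
    ∃ K : ℝ, 0 ≤ K ∧ ∀ (l : ℕ) (t : ℝ), 0 ≤ t →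
      ‖expKernel x (t * u / (l + 1)) / (l + 1) ^ 2‖ ≤ K * (1 / ((l : ℝ) + 1) ^ 2) := by
  obtain ⟨K, hK⟩ := exists_norm_expKernel_ray_le hx hx1 hu
  refine ⟨K, (norm_nonneg _).trans (hK 0 le_rfl), fun l t ht => ?_⟩
  have h3 : ‖(l : ℂ) + 1‖ = l + 1 := by exact_mod_cast Complex.norm_natCast (l + 1)
  rw [norm_div, norm_pow, h3, div_eq_mul_one_div]
  gcongr
  have e : (t : ℂ) * u / (l + 1) = ((t / (l + 1) : ℝ) : ℂ) * u := by push_cast; ring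
  rw [e]
  exact hK _ (by positivity)

lemma continuousOn_borelSeries_ray {x u : ℂ} (hx : ‖x‖ = 1) (hx1 : x ≠ 1) (hu : 0 < u.re) :
    ContinuousOn (fun t : ℝ => borelSeries x (t * u)) (Set.Ici 0) := by
  obtain ⟨K, hK0, hK⟩ := exists_norm_borel_ray_term_le hx hx1 hu
  refine continuousOn_tsum (fun l => ?_) (summable_inv_succ_sq.mul_left K) fun l t ht => hK l t ht
  refine (Continuous.div_const ?_ _).continuousOn
  simp_rw [ray_div_succ, mul_assoc]
  exact continuous_expKernel_ray hx hx1 (by rw [re_mul_ofReal]; positivity)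

lemma exists_norm_borelSeries_ray_le {x u : ℂ} (hx : ‖x‖ = 1) (hx1 : x ≠ 1) (hu : 0 < u.re) :
    ∃ K : ℝ, ∀ t : ℝ, 0 ≤ t → ‖borelSeries x (t * u)‖ ≤ K := by
  obtain ⟨K, hK0, hK⟩ := exists_norm_borel_ray_term_le hx hx1 hu
  exact ⟨_, fun t ht => tsum_of_norm_bounded (summable_inv_succ_sq.mul_left K).hasSum
    fun l => hK l t ht⟩

lemma integrableOn_laplace_of_bounded {u y : ℂ} {f : ℝ → ℂ} {K : ℝ} (huy : 0 < (u / y).re)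
    (hc : ContinuousOn f (Set.Ici 0)) (hK : ∀ t : ℝ, 0 ≤ t → ‖f t‖ ≤ K) :
    IntegrableOn (fun t : ℝ => cexp (-(t * u) / y) * f t * u) (Set.Ioi 0) := by
  have hE : IntegrableOn (fun t : ℝ => cexp (-(t * u) / y)) (Set.Ioi 0) := by
    refine (integrableOn_exp_neg_mul huy).congr_fun (fun t _ => ?_) measurableSet_Ioi
    simp only
    congr 1; ring
  refine (hE.mul_bdd (c := K) ?_ ?_).mul_const u
  · exact (hc.mono Set.Ioi_subset_Ici_self).aestronglyMeasurable measurableSet_Ioi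
  · filter_upwards [ae_restrict_mem measurableSet_Ioi] with t ht
    exact hK t (le_of_lt ht)

lemma integrableOn_laplace_borelSeries {x u y : ℂ} (hx : ‖x‖ = 1) (hx1 : x ≠ 1) (hu : 0 < u.re)
    (huy : 0 < (u / y).re) :
    IntegrableOn (fun t : ℝ => cexp (-(t * u) / y) * borelSeries x (t * u) * u) (Set.Ioi 0) :=
  (exists_norm_borelSeries_ray_le hx hx1 hu).elim fun _ hK =>
    integrableOn_laplace_of_bounded huy (continuousOn_borelSeries_ray hx hx1 hu) hK

/-- The Laplace transform of `borelSeries x` along a ray in the right half-plane. -/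
lemma laplace_borelSeries {x u y : ℂ} (hx : ‖x‖ = 1) (hx1 : x ≠ 1) (hu : 0 < u.re)
    (huy : 0 < (u / y).re) :
    ∫ t : ℝ in Set.Ioi 0, cexp (-(t * u) / y) * borelSeries x (t * u) * u = laplaceSeries x y := by
  have hy : y ≠ 0 := by rintro rfl; simp at huy
  obtain ⟨δ, hδ, hlin⟩ := exists_norm_linear_ge hu huy
  have hlin0 : ∀ l m : ℕ, (l : ℂ) + 1 + m * y ≠ 0 := fun l m h => by
    have := hlin l m
    rw [h, norm_zero] at this
    exact absurd this (not_le.2 (by positivity))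
  obtain ⟨K, hK0, hK⟩ := exists_norm_borel_ray_term_le hx hx1 hu
  set F : ℕ → ℝ → ℂ := fun l t =>
    cexp (-(t * u) / y) * (expKernel x (t * u / (l + 1)) / (l + 1) ^ 2) * u with hF
  have hc : ∀ l : ℕ, Continuous fun t : ℝ => expKernel x (t * u / (l + 1)) / (l + 1) ^ 2 :=
    fun l => by
      refine Continuous.div_const ?_ _
      simp_rw [ray_div_succ, mul_assoc]
      exact continuous_expKernel_ray hx hx1 (by rw [re_mul_ofReal]; positivity)
  have hFint : ∀ l, Integrable (F l) (volume.restrict (Set.Ioi 0)) := fun l =>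
    integrableOn_laplace_of_bounded huy (hc l).continuousOn (hK l)
  have hE : IntegrableOn (fun t : ℝ => ‖cexp (-(t * u) / y)‖) (Set.Ioi 0) := by
    refine IntegrableOn.congr_fun (integrableOn_exp_neg_mul huy).norm (fun t _ => ?_)
      measurableSet_Ioi
    congr 2; ring
  have hFsum : Summable fun l => ∫ t in Set.Ioi 0, ‖F l t‖ := by
    refine (summable_inv_succ_sq.mul_left
      (K * ‖u‖ * ∫ t : ℝ in Set.Ioi 0, ‖cexp (-(t * u) / y)‖)).of_nonneg_of_le
      (fun l => integral_nonneg fun t => norm_nonneg _) fun l => ?_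
    have e : K * ‖u‖ * (∫ t : ℝ in Set.Ioi 0, ‖cexp (-(t * u) / y)‖) * (1 / ((l : ℝ) + 1) ^ 2) =
        ∫ t : ℝ in Set.Ioi 0, ‖cexp (-(t * u) / y)‖ * (K * (1 / ((l : ℝ) + 1) ^ 2) * ‖u‖) := by
      rw [integral_mul_const]; ring
    rw [e]
    refine setIntegral_mono_on (hFint l).norm (hE.mul_const _) measurableSet_Ioi fun t ht => ?_
    simp only [hF]
    rw [norm_mul, norm_mul, mul_assoc]
    gcongr
    exact hK l t (le_of_lt ht)
  have hH := hasSum_integral_of_summable_integral_norm hFint hFsum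
  have hS : ∀ t : ℝ, cexp (-(t * u) / y) * borelSeries x (t * u) * u = ∑' l, F l t := fun t => by
    simp only [hF, borelSeries]
    rw [tsum_mul_right, tsum_mul_left]
  have hval : ∀ l : ℕ, ∫ t in Set.Ioi 0, F l t =
      x / (1 - x) * (y * (1 / ((l : ℂ) + 1) ^ 2) - ∑' m : ℕ, x ^ m * laplaceTerm y l m) := fun l => by
    have hr : (0 : ℝ) < 1 / ((l : ℝ) + 1) := by positivity
    have e : ∀ t : ℝ, F l t = 1 / ((l : ℂ) + 1) ^ 2 *
        (cexp (-(t * u) / y) * expKernel x (t * u * ((1 / (l + 1 : ℝ) : ℝ) : ℂ)) * u) := fun t => by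
      simp only [hF, ray_div_succ]; ring
    have hl : (l : ℂ) + 1 ≠ 0 := by exact_mod_cast l.succ_ne_zero
    simp_rw [e]
    rw [integral_const_mul, laplace_expKernel hx hx1 hu huy hr, mul_left_comm, mul_sub,
      ← tsum_mul_left, mul_comm y]
    congr 3
    funext m
    rw [mul_left_comm]
    congr 1
    have h1 := hlin0 l m
    have h2 := hlin0 l (m + 1)
    push_cast at h2 ⊢
    have e1 : 1 / y + (m : ℂ) * (1 / (l + 1)) = (l + 1 + m * y) / (y * (l + 1)) := by
      field_simp
    have e2 : 1 / y + ((m : ℂ) + 1) * (1 / (l + 1)) = (l + 1 + (m + 1) * y) / (y * (l + 1)) := by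
      field_simp
    have e3 : (l : ℂ) + 1 + (m + 1) * y = l + 1 + m * y + y := by ring
    rw [laplaceTerm, e1, e2]
    rw [e3] at h2 ⊢
    generalize (l : ℂ) + 1 + m * y = A at h1 h2
    field_simp
    ring
  simp_rw [hS]
  rw [← hH.tsum_eq]
  simp_rw [hval]
  have hp := summable_laplaceTerm hx hu huy
  rw [tsum_mul_left, laplaceSeries, hp.tsum_prod,
    Summable.tsum_sub (hasSum_inv_succ_sq.mul_left y).summable hp.prod, tsum_mul_left,
    hasSum_inv_succ_sq.tsum_eq]

/-! ### Analytic continuation and reflection of the Borel transform. -/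

/-- The plane cut along the two half-lines `± i [ρ, ∞)`. -/
def slitDomain (ρ : ℝ) : Set ℂ := {w : ℂ | w.re ≠ 0 ∨ |w.im| < ρ}

/-- The double sector `|Re y| ≤ M |Im y|`, without its vertex. -/
def doubleSector (M : ℝ) : Set ℂ := {y : ℂ | y.im ≠ 0 ∧ |y.re| ≤ M * |y.im|}

lemma isOpen_slitDomain (ρ : ℝ) : IsOpen (slitDomain ρ) := by
  have h1 : IsOpen {w : ℂ | w.re ≠ 0} := isOpen_ne_fun continuous_re continuous_const
  have h2 : IsOpen {w : ℂ | |w.im| < ρ} := isOpen_lt continuous_im.abs continuous_const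
  exact h1.union h2

lemma zero_mem_slitDomain {ρ : ℝ} (hρ : 0 < ρ) : (0 : ℂ) ∈ slitDomain ρ := by
  right; simpa using hρ

lemma smul_mem_slitDomain {ρ : ℝ} (hρ : 0 < ρ) {w : ℂ} (hw : w ∈ slitDomain ρ) {t : ℝ}
    (h0 : 0 ≤ t) (h1 : t ≤ 1) : (t : ℂ) * w ∈ slitDomain ρ := by
  rcases h0.eq_or_lt with rfl | h0
  · simpa using zero_mem_slitDomain hρ
  · rcases hw with h | h
    · left; simpa [h0.ne'] using h
    · right
      rw [im_ofReal_mul, abs_mul, abs_of_pos h0]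
      exact (mul_le_of_le_one_left (abs_nonneg _) h1).trans_lt h

lemma starConvex_slitDomain {ρ : ℝ} (hρ : 0 < ρ) : StarConvex ℝ 0 (slitDomain ρ) := by
  rw [starConvex_zero_iff]
  intro w hw t h0 h1
  simpa using smul_mem_slitDomain hρ hw h0 h1

lemma neg_mem_slitDomain {ρ : ℝ} {w : ℂ} (hw : w ∈ slitDomain ρ) : -w ∈ slitDomain ρ := by
  simpa [slitDomain] using hw

lemma ray_mem_slitDomain {ρ : ℝ} (hρ : 0 < ρ) {u : ℂ} (hu : u.re ≠ 0) (t : ℝ) :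
    (t : ℂ) * u ∈ slitDomain ρ := by
  rcases eq_or_ne t 0 with rfl | ht
  · simpa using zero_mem_slitDomain hρ
  · left; simp [ht, hu]

/-- A solution of e^w = x is purely imaginary with N w ∈ 2πiℤ. Below height 2π/N the only candidate
is w = 0, which x ≠ 1 rules out. -/
lemma exp_ne_of_mem_slitDomain {N : ℕ} (hN : N ≠ 0) {x w : ℂ} (hx : x ^ N = 1) (hx1 : x ≠ 1)
    (hw : w ∈ slitDomain (2 * Real.pi / N)) : cexp w ≠ x := by
  rintro rfl
  have hn := norm_eq_one_of_pow_eq_one hx hN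
  rw [norm_exp, Real.exp_eq_one_iff] at hn
  have him : |w.im| < 2 * Real.pi / N := hw.resolve_left (by simpa using hn)
  rw [← Complex.exp_nat_mul, Complex.exp_eq_one_iff] at hx
  obtain ⟨n, hn'⟩ := hx
  have h2 : (N : ℝ) * w.im = n * (2 * Real.pi) := by
    have := congrArg Complex.im hn'
    simpa using this
  have hN' : (0 : ℝ) < N := by exact_mod_cast Nat.pos_of_ne_zero hN
  have h3 : |(n : ℝ)| < 1 := by
    rw [lt_div_iff₀ hN', mul_comm, ← abs_of_pos hN', ← abs_mul, h2, abs_mul,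
      abs_of_pos Real.two_pi_pos] at him
    nlinarith [Real.two_pi_pos]
  have h4 : n = 0 := by
    have : |n| < 1 := by exact_mod_cast h3
    exact Int.abs_lt_one_iff.1 this
  rw [h4] at h2
  have h5 : w.im = 0 := by simpa [hN'.ne'] using h2
  have h6 : w = 0 := Complex.ext (by simpa using hn) (by simpa using h5)
  exact hx1 (by simp [h6])

lemma differentiableOn_borelSeries {x : ℂ} {ρ : ℝ} (hρ : 0 < ρ)
    (hD : ∀ w ∈ slitDomain ρ, cexp w ≠ x) : DifferentiableOn ℂ (borelSeries x) (slitDomain ρ) := by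
  have hk : DifferentiableOn ℂ (expKernel x) (slitDomain ρ) := fun w hw =>
    (DifferentiableAt.fun_div (differentiableAt_const x)
      (differentiableAt_exp.sub_const x) (sub_ne_zero.2 (hD w hw))).differentiableWithinAt
  intro z hz
  obtain ⟨ε, hε, hball⟩ := Metric.nhds_basis_closedBall.mem_iff.1 ((isOpen_slitDomain ρ).mem_nhds hz)
  -- All the points w / (l + 1) with w near z lie in this union of segments towards 0, so one bound
  -- of the kernel on a compact set gives the majorant K / (l + 1)².
  have hcomp : IsCompact ((fun p : ℝ × ℂ => (p.1 : ℂ) * p.2) ''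
      (Set.Icc 0 1 ×ˢ Metric.closedBall z ε)) :=
    (isCompact_Icc.prod (isCompact_closedBall z ε)).image (by fun_prop)
  obtain ⟨K, hK⟩ := hcomp.exists_bound_of_continuousOn (f := expKernel x) <|
    hk.continuousOn.mono <| by
      rintro _ ⟨⟨t, w⟩, ⟨ht, hw⟩, rfl⟩
      exact smul_mem_slitDomain hρ (hball hw) ht.1 ht.2
  have hdiv : ∀ (l : ℕ) (w : ℂ), w / (l + 1) = ((1 / (l + 1) : ℝ) : ℂ) * w := fun l w => by
    push_cast; ring
  have h01 : ∀ l : ℕ, (0 : ℝ) ≤ 1 / (l + 1) ∧ 1 / ((l : ℝ) + 1) ≤ 1 := fun l =>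
    ⟨by positivity, (div_le_one (by positivity)).2 (by linarith [l.cast_nonneg (α := ℝ)])⟩
  have h := differentiableOn_tsum_of_summable_norm (U := Metric.ball z ε)
    (F := fun (l : ℕ) ζ => expKernel x (ζ / (l + 1)) / (l + 1) ^ 2)
    (u := fun l : ℕ => K * (1 / ((l : ℝ) + 1) ^ 2)) (summable_inv_succ_sq.mul_left K) (fun l => ?_)
    Metric.isOpen_ball fun l w hw => ?_
  · exact (h.differentiableAt (Metric.ball_mem_nhds z hε)).differentiableWithinAt
  · refine DifferentiableOn.div_const ?_ _
    refine hk.comp (by fun_prop) fun w hw => ?_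
    rw [hdiv]
    exact smul_mem_slitDomain hρ (hball (Metric.ball_subset_closedBall hw)) (h01 l).1 (h01 l).2
  · have h3 : ‖(l : ℂ) + 1‖ = l + 1 := by exact_mod_cast Complex.norm_natCast (l + 1)
    rw [norm_div, norm_pow, h3, div_eq_mul_one_div]
    gcongr
    exact hK _ ⟨(1 / (l + 1), w), ⟨h01 l, Metric.ball_subset_closedBall hw⟩, (hdiv l w).symm⟩

/-- This symmetry between x and x⁻¹ is what lets the parity of χ enter: it relates the Borel
transform on the two sides of its cuts. -/
lemma expKernel_neg {x w : ℂ} (hx : x ≠ 0) (hw : cexp w ≠ x⁻¹) :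
    expKernel x (-w) = -1 - expKernel x⁻¹ w := by
  have h1 : cexp w - x⁻¹ ≠ 0 := sub_ne_zero.2 hw
  have h2 : cexp (-w) - x ≠ 0 := by
    refine sub_ne_zero.2 fun h => hw ?_
    rw [← h, ← Complex.exp_neg, neg_neg]
  have h5 : cexp w * cexp (-w) = 1 := by rw [← Complex.exp_add]; simp
  have h6 : x * cexp w - 1 ≠ 0 := by
    intro h
    apply h1
    field_simp
    linear_combination h
  unfold expKernel
  field_simp
  linear_combination x * h5

lemma borelSeries_neg_ray {x u : ℂ} (hx : ‖x‖ = 1) (hx1 : x ≠ 1) (hu : 0 < u.re) {t : ℝ}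
    (ht : 0 ≤ t) : borelSeries x (-(t * u)) = -((Real.pi : ℂ) ^ 2 / 6) - borelSeries x⁻¹ (t * u) := by
  have hx0 : x ≠ 0 := by rintro rfl; simp at hx
  have hi : ‖x⁻¹‖ = 1 := by simp [hx]
  have hi1 : x⁻¹ ≠ 1 := by simpa using hx1
  obtain ⟨K, -, hK⟩ := exists_norm_borel_ray_term_le hi hi1 hu
  have hs : Summable fun l : ℕ => expKernel x⁻¹ (t * u / (l + 1)) / (l + 1) ^ 2 :=
    (summable_inv_succ_sq.mul_left K).of_norm_bounded fun l => hK l t ht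
  unfold borelSeries
  rw [← hasSum_inv_succ_sq.tsum_eq, ← tsum_neg, ← hasSum_inv_succ_sq.summable.neg.tsum_sub hs]
  refine tsum_congr fun l => ?_
  have e : (t : ℂ) * u / (l + 1) = ((t / (l + 1) : ℝ) : ℂ) * u := by push_cast; ring
  rw [neg_div, expKernel_neg hx0 (by rw [e]; exact exp_ray_ne hi hi1 hu _)]
  ring

/-! ### Watson's lemma, uniformly in double sectors. -/

/-- The Taylor remainder of a function which is analytic at `0` and bounded along a ray is
dominated by the corresponding power along the whole ray. -/
lemma exists_norm_taylor_remainder_ray_le {f : ℂ → ℂ} (hf : AnalyticAt ℂ f 0) {u : ℂ} {K : ℝ}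
    (hK : ∀ t : ℝ, 0 ≤ t → ‖f (t * u)‖ ≤ K) (n : ℕ) :
    ∃ C : ℝ, ∀ t : ℝ, 0 < t →
      ‖f (t * u) - ∑ j ∈ Finset.range n, iteratedDeriv j f 0 / j.factorial * (t * u) ^ j‖ ≤
        C * t ^ n := by
  have h := hf.hasFPowerSeriesAt.isBigO_sub_partialSum_pow n
  obtain ⟨c, hc⟩ := h.bound
  obtain ⟨r, hr, hrc⟩ := Metric.eventually_nhds_iff.1 hc
  set s : ℝ := r / (‖u‖ + 1) with hs
  have hs0 : 0 < s := by positivity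
  -- For t ≥ s and j ≤ n one has t^j ≤ t^n / s^(n - j), so S t^n dominates the Taylor polynomial
  -- away from 0.
  set S : ℝ := ∑ j ∈ Finset.range n, ‖iteratedDeriv j f 0 / j.factorial‖ * ‖u‖ ^ j / s ^ (n - j)
  refine ⟨max (c * ‖u‖ ^ n) (K / s ^ n + S), fun t ht => ?_⟩
  rcases lt_or_ge t s with hts | hts
  · have h1 : ‖(t : ℂ) * u‖ < r := by
      rw [norm_mul, norm_real, Real.norm_of_nonneg ht.le]
      rw [hs, lt_div_iff₀ (by positivity)] at hts
      nlinarith [norm_nonneg u]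
    have h2 := hrc (y := (t : ℂ) * u) (by simpa using h1)
    rw [zero_add] at h2
    have e : (FormalMultilinearSeries.ofScalars ℂ
        fun n => iteratedDeriv n f 0 / n.factorial).partialSum n ((t : ℂ) * u) =
        ∑ j ∈ Finset.range n, iteratedDeriv j f 0 / j.factorial * (t * u) ^ j := by
      simp [FormalMultilinearSeries.partialSum, mul_comm]
    rw [e] at h2
    refine h2.trans (le_trans (le_of_eq ?_)
      (mul_le_mul_of_nonneg_right (le_max_left _ _) (by positivity)))
    rw [norm_pow, norm_norm, norm_mul, norm_real, Real.norm_of_nonneg ht.le]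
    ring
  · refine (norm_sub_le _ _).trans (le_trans ?_
      (mul_le_mul_of_nonneg_right (le_max_right _ _) (by positivity)))
    have hK0 : 0 ≤ K := (norm_nonneg _).trans (hK 0 le_rfl)
    rw [add_mul]
    refine add_le_add ((hK t ht.le).trans ?_) ((norm_sum_le _ _).trans ?_)
    · rw [div_mul_eq_mul_div, le_div_iff₀ (by positivity)]
      gcongr
    · rw [Finset.sum_mul]
      refine Finset.sum_le_sum fun j hj => ?_
      have hjn : j ≤ n := (Finset.mem_range.1 hj).le
      rw [norm_mul, norm_pow, norm_mul, norm_real, Real.norm_of_nonneg ht.le, mul_pow,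
        div_mul_eq_mul_div, le_div_iff₀ (by positivity)]
      calc ‖iteratedDeriv j f 0 / j.factorial‖ * (t ^ j * ‖u‖ ^ j) * s ^ (n - j)
          ≤ ‖iteratedDeriv j f 0 / j.factorial‖ * (t ^ j * ‖u‖ ^ j) * t ^ (n - j) := by gcongr
        _ = _ := by
          rw [← Nat.add_sub_cancel' hjn, pow_add]
          simp only [Nat.add_sub_cancel_left]
          ring

/-- Watson's lemma for `borelSeries`, with the dependence on `y` made explicit. -/
lemma exists_norm_laplaceSeries_sub_le {x u : ℂ} (hx : ‖x‖ = 1) (hx1 : x ≠ 1)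
    (ha : AnalyticAt ℂ (borelSeries x) 0) (hu : 0 < u.re) (n : ℕ) :
    ∃ C : ℝ, ∀ y : ℂ, 0 < (u / y).re →
      ‖laplaceSeries x y - ∑ j ∈ Finset.range n, iteratedDeriv j (borelSeries x) 0 * y ^ (j + 1)‖ ≤
        C / (u / y).re ^ (n + 1) := by
  obtain ⟨K, hK⟩ := exists_norm_borelSeries_ray_le hx hx1 hu
  obtain ⟨C, hC⟩ := exists_norm_taylor_remainder_ray_le ha hK n
  have hu0 : u ≠ 0 := by rintro rfl; simp at hu
  refine ⟨C * ‖u‖ * n.factorial, fun y huy => ?_⟩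
  have hy : y ≠ 0 := by rintro rfl; simp at huy
  have e0 : ∀ t : ℝ, cexp (-(t * u) / y) = cexp (-(u / y * t)) := fun t => by congr 1; ring
  have hj : ∀ j : ℕ, (fun t : ℝ => cexp (-(t * u) / y) *
      (iteratedDeriv j (borelSeries x) 0 / j.factorial * (t * u) ^ j) * u) = fun t : ℝ =>
      (iteratedDeriv j (borelSeries x) 0 / j.factorial * u ^ (j + 1)) *
        ((t : ℂ) ^ j * cexp (-(u / y * t))) := fun j => by
    funext t; rw [e0]; ring
  have hji : ∀ j : ℕ, IntegrableOn (fun t : ℝ => cexp (-(t * u) / y) *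
      (iteratedDeriv j (borelSeries x) 0 / j.factorial * (t * u) ^ j) * u) (Set.Ioi 0) := fun j => by
    rw [hj]
    exact (integrableOn_pow_mul_exp_neg_mul huy j).const_mul _
  have hjv : ∀ j : ℕ, ∫ t : ℝ in Set.Ioi 0, cexp (-(t * u) / y) *
      (iteratedDeriv j (borelSeries x) 0 / j.factorial * (t * u) ^ j) * u =
      iteratedDeriv j (borelSeries x) 0 * y ^ (j + 1) := fun j => by
    rw [hj, integral_const_mul, integral_pow_mul_exp_neg_mul huy]
    have : (j.factorial : ℂ) ≠ 0 := by exact_mod_cast j.factorial_ne_zero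
    rw [div_pow]
    field_simp
  have hdiff : laplaceSeries x y -
      ∑ j ∈ Finset.range n, iteratedDeriv j (borelSeries x) 0 * y ^ (j + 1) =
      ∫ t : ℝ in Set.Ioi 0, cexp (-(t * u) / y) * (borelSeries x (t * u) -
        ∑ j ∈ Finset.range n,
          iteratedDeriv j (borelSeries x) 0 / j.factorial * (t * u) ^ j) * u := by
    simp_rw [mul_sub, sub_mul, Finset.mul_sum, Finset.sum_mul]
    rw [integral_sub (integrableOn_laplace_borelSeries hx hx1 hu huy)
      (integrable_finsetSum _ fun j _ => hji j), laplace_borelSeries hx hx1 hu huy,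
      integral_finsetSum _ fun j _ => hji j]
    simp_rw [hjv]
  -- The real integral of t^n e^{-at} is read off from the complex formula at the real parameter a =
  -- Re (u / y).
  have hint := (integrableOn_pow_mul_exp_neg_mul (k := ((u / y).re : ℂ)) (by simpa using huy) n)
  have hval := integral_pow_mul_exp_neg_mul (k := ((u / y).re : ℂ)) (by simpa using huy) n
  have hcast : ∀ t : ℝ, (t : ℂ) ^ n * cexp (-(((u / y).re : ℂ) * t)) =
      ((t ^ n * Real.exp (-((u / y).re * t)) : ℝ) : ℂ) := fun t => by push_cast; rfl
  simp_rw [hcast] at hint hval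
  rw [integral_complex_ofReal] at hval
  have hval' : ∫ t : ℝ in Set.Ioi 0, t ^ n * Real.exp (-((u / y).re * t)) =
      n.factorial / (u / y).re ^ (n + 1) := by exact_mod_cast hval
  have hint' : IntegrableOn (fun t : ℝ => t ^ n * Real.exp (-((u / y).re * t))) (Set.Ioi 0) := by
    have h := hint.re
    simp only [RCLike.re_to_complex, ofReal_re] at h
    exact h
  rw [hdiff, mul_div_assoc, ← hval', ← integral_const_mul]
  refine norm_integral_le_of_norm_le (hint'.const_mul _) ?_
  filter_upwards [ae_restrict_mem measurableSet_Ioi] with t ht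
  rw [norm_mul, norm_mul, e0, norm_exp]
  have e3 : (-(u / y * t)).re = -((u / y).re * t) := by rw [neg_re, re_mul_ofReal]
  rw [e3]
  calc _ ≤ Real.exp (-((u / y).re * t)) * (C * t ^ n) * ‖u‖ := by gcongr; exact hC t ht
    _ = _ := by ring

/-- Every double sector is covered by two directions of summation in the right half-plane. -/
lemma exists_direction (M : ℝ) : ∃ u v : ℂ, ∃ κ : ℝ, 0 < u.re ∧ 0 < v.re ∧ 0 < κ ∧
    ∀ y ∈ doubleSector M, κ / ‖y‖ ≤ (u / y).re ∨ κ / ‖y‖ ≤ (v / y).re := by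
  -- The slanted directions 1 ± ia serve the upper and the lower half of the double sector. With a =
  -- |M| + 1 the numerator Re y + a |Im y| of the real part is at least |Im y|, hence comparable to
  -- ‖y‖.
  set a : ℝ := |M| + 1 with ha
  have ha0 : 0 < a := by positivity
  refine ⟨⟨1, a⟩, ⟨1, -a⟩, 1 / a, by simp, by simp, by positivity, fun y ⟨hy, hyM⟩ => ?_⟩
  have hy0 : y ≠ 0 := by rintro rfl; simp at hy
  have hn : 0 < ‖y‖ := norm_pos_iff.2 hy0
  have him : 0 < |y.im| := abs_pos.2 hy
  have h1 : |y.re| ≤ |M| * |y.im| := hyM.trans (by gcongr; exact le_abs_self M)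
  have h2 : ‖y‖ ≤ a * |y.im| := (norm_le_abs_re_add_abs_im y).trans (by rw [ha]; linarith)
  have h3 := neg_abs_le y.re
  have key : 1 / a / ‖y‖ ≤ (y.re + a * |y.im|) / normSq y := by
    rw [normSq_eq_norm_sq, div_div, div_le_div_iff₀ (by positivity) (by positivity)]
    have h4 : |y.im| ≤ y.re + a * |y.im| := by rw [ha]; linarith
    calc 1 * ‖y‖ ^ 2 = ‖y‖ * ‖y‖ := by ring
      _ ≤ (a * |y.im|) * ‖y‖ := by gcongr
      _ = |y.im| * (a * ‖y‖) := by ring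
      _ ≤ _ := by gcongr
  rcases lt_or_gt_of_ne hy with h | h
  · right
    rw [abs_of_neg h] at key
    rw [div_re]
    refine key.trans_eq ?_
    simp only
    ring
  · left
    rw [abs_of_pos h] at key
    rw [div_re]
    refine key.trans_eq ?_
    simp only
    ring

lemma exists_norm_laplaceSeries_sub_le_sector {x : ℂ} (hx : ‖x‖ = 1) (hx1 : x ≠ 1)
    (ha : AnalyticAt ℂ (borelSeries x) 0) (M : ℝ) (n : ℕ) :
    ∃ C : ℝ, ∀ y ∈ doubleSector M,
      ‖laplaceSeries x y - ∑ j ∈ Finset.range n, iteratedDeriv j (borelSeries x) 0 * y ^ (j + 1)‖ ≤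
        C * ‖y‖ ^ (n + 1) := by
  obtain ⟨u, v, κ, hu, hv, hκ, h⟩ := exists_direction M
  obtain ⟨C₁, hC₁⟩ := exists_norm_laplaceSeries_sub_le hx hx1 ha hu n
  obtain ⟨C₂, hC₂⟩ := exists_norm_laplaceSeries_sub_le hx hx1 ha hv n
  refine ⟨max |C₁| |C₂| / κ ^ (n + 1), fun y hy => ?_⟩
  have hy0 : y ≠ 0 := by rintro rfl; simp [doubleSector] at hy
  have hn : 0 < ‖y‖ := norm_pos_iff.2 hy0
  have key : ∀ {w : ℂ} {C : ℝ}, κ / ‖y‖ ≤ (w / y).re → |C| ≤ max |C₁| |C₂| →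
      C / (w / y).re ^ (n + 1) ≤ max |C₁| |C₂| / κ ^ (n + 1) * ‖y‖ ^ (n + 1) := by
    intro w C hw hC
    have e : max |C₁| |C₂| / κ ^ (n + 1) * ‖y‖ ^ (n + 1) =
        max |C₁| |C₂| / (κ / ‖y‖) ^ (n + 1) := by
      rw [div_pow]; field_simp
    rw [e]
    have : 0 < (w / y).re := lt_of_lt_of_le (by positivity) hw
    refine (div_le_div_of_nonneg_right ((le_abs_self C).trans hC) (by positivity)).trans ?_
    gcongr
  have hpos : 0 < κ / ‖y‖ := by positivity
  rcases h y hy with h | h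
  · exact (hC₁ y (hpos.trans_le h)).trans (key h (le_max_left _ _))
  · exact (hC₂ y (hpos.trans_le h)).trans (key h (le_max_right _ _))

/-! ### The `q`-Pochhammer symbol as a Lambert series. -/

lemma one_sub_mem_slitPlane {x : ℂ} (hx : ‖x‖ = 1) (hx1 : x ≠ 1) : 1 - x ∈ slitPlane := by
  left
  have h1 : x.re ≤ 1 := (re_le_norm x).trans_eq hx
  have h2 : x.re ≠ 1 := fun h => hx1 <| by
    have h3 : x.re ^ 2 + x.im ^ 2 = 1 := by
      have := Complex.sq_norm x
      rw [hx, normSq_apply] at this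
      nlinarith
    rw [h] at h3
    have h4 : x.im = 0 := by nlinarith
    exact Complex.ext (by simp [h]) (by simp [h4])
  simpa using lt_of_le_of_ne h1 h2

lemma hasSum_neg_log_one_sub {z : ℂ} (hz : ‖z‖ < 1) :
    HasSum (fun m : ℕ => z ^ (m + 1) / (m + 1)) (-log (1 - z)) := by
  have h := (hasSum_nat_add_iff' 1).2 (Complex.hasSum_taylorSeries_neg_log hz)
  simpa using h

/-- The logarithmic series at a point `x ≠ 1` of the unit circle. -/
lemma tendsto_sum_pow_div_succ {x : ℂ} (hx : ‖x‖ = 1) (hx1 : x ≠ 1) :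
    Tendsto (fun M => ∑ m ∈ Finset.range M, x ^ (m + 1) / ((m : ℂ) + 1)) atTop
      (𝓝 (-log (1 - x))) := by
  have hx1' : 0 < ‖x - 1‖ := norm_pos_iff.2 (sub_ne_zero.2 hx1)
  -- Dirichlet's test: the weights decrease to 0 and the geometric sums are bounded by 2 / ‖x - 1‖.
  have hcs : CauchySeq fun M => ∑ m ∈ Finset.range M, (1 / ((m : ℝ) + 1)) • x ^ (m + 1) := by
    refine Antitone.cauchySeq_series_mul_of_tendsto_zero_of_bounded (b := 2 / ‖x - 1‖)
      (fun a b h => ?_) tendsto_one_div_add_atTop_nhds_zero_nat fun n => ?_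
    · exact one_div_le_one_div_of_le (by positivity) (by gcongr)
    · simp_rw [pow_succ]
      rw [← Finset.sum_mul, geom_sum_eq hx1, norm_mul, norm_div, hx, mul_one]
      gcongr
      refine (norm_sub_le _ _).trans_eq ?_
      rw [norm_pow, hx]; norm_num
  obtain ⟨l, hl⟩ := cauchySeq_tendsto_of_complete hcs
  have hl' : Tendsto (fun M => ∑ m ∈ Finset.range M, x ^ (m + 1) / ((m : ℂ) + 1)) atTop (𝓝 l) := by
    refine hl.congr fun M => Finset.sum_congr rfl fun m _ => ?_
    rw [real_smul]; push_cast; ring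
  -- Abel's limit theorem identifies the sum. The series starts at exponent 0 in r, whence the extra
  -- factor r below.
  have habel := Complex.tendsto_tsum_powerSeries_nhdsWithin_lt hl'
  rw [tendsto_map'_iff] at habel
  have h1 : Tendsto (fun r : ℝ => -log (1 - x * r)) (𝓝[<] 1) (𝓝 (-log (1 - x))) := by
    have hc : ContinuousAt (fun r : ℝ => -log (1 - x * r)) 1 := by
      refine ContinuousAt.neg (ContinuousAt.clog (by fun_prop) ?_)
      simpa using one_sub_mem_slitPlane hx hx1
    simpa using hc.tendsto.mono_left nhdsWithin_le_nhds
  have h2 : Tendsto (fun r : ℝ => (∑' n : ℕ, x ^ (n + 1) / ((n : ℂ) + 1) * (r : ℂ) ^ n) * r) (𝓝[<] 1)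
      (𝓝 (l * (1 : ℝ))) :=
    habel.mul ((continuous_ofReal.tendsto 1).mono_left nhdsWithin_le_nhds)
  have h3 : l = -log (1 - x) := by
    refine tendsto_nhds_unique (by simpa using h2) (h1.congr' ?_)
    filter_upwards [Ioo_mem_nhdsLT (show (0 : ℝ) < 1 by norm_num)] with r hr
    have hlt : ‖x * r‖ < 1 := by
      rw [norm_mul, hx, one_mul, norm_real, Real.norm_of_nonneg hr.1.le]; exact hr.2
    rw [← (hasSum_neg_log_one_sub hlt).tsum_eq, ← tsum_mul_right]
    refine tsum_congr fun n => ?_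
    rw [mul_pow, pow_succ (r : ℂ)]
    ring
  rwa [← h3]

/-- The Lambert series `∑_{m ≥ 1} (x ^ m / m) q ^ m / (1 - q ^ m)`. -/
noncomputable def lambertSeries (x q : ℂ) : ℂ :=
  ∑' m : ℕ, x ^ (m + 1) / (m + 1) * (q ^ (m + 1) / (1 - q ^ (m + 1)))

lemma hasSum_pow_mul_succ {q : ℂ} (hq : ‖q‖ < 1) (m : ℕ) :
    HasSum (fun n : ℕ => (q ^ (n + 1)) ^ (m + 1)) (q ^ (m + 1) / (1 - q ^ (m + 1))) := by
  have hlt : ‖q ^ (m + 1)‖ < 1 := by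
    rw [norm_pow]; exact pow_lt_one₀ (norm_nonneg _) hq m.succ_ne_zero
  have h := (hasSum_geometric_of_norm_lt_one hlt).mul_left (q ^ (m + 1))
  rw [div_eq_mul_inv]
  refine h.congr_fun fun n => ?_
  rw [← pow_mul, ← pow_mul, ← pow_add]
  congr 1; ring

lemma summable_lambert_pair {x q : ℂ} (hx : ‖x‖ = 1) (hq : ‖q‖ < 1) :
    Summable fun p : ℕ × ℕ => (x * q ^ (p.1 + 1)) ^ (p.2 + 1) / ((p.2 : ℂ) + 1) := by
  -- The majorant |q|^n |q|^m suffices because (n + 1)(m + 1) ≥ n + m.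
  have hg := summable_geometric_of_lt_one (norm_nonneg q) hq
  refine Summable.of_norm_bounded (hg.mul_of_nonneg hg (fun _ => by positivity)
    fun _ => by positivity) ?_
  rintro ⟨n, m⟩
  have h3 : ‖(m : ℂ) + 1‖ = m + 1 := by exact_mod_cast Complex.norm_natCast (m + 1)
  simp only [norm_div, norm_pow, norm_mul, hx, one_mul, h3]
  refine (div_le_self (by positivity) (by linarith [m.cast_nonneg (α := ℝ)])).trans ?_
  rw [← pow_mul, ← pow_add]
  exact pow_le_pow_of_le_one (norm_nonneg _) hq.le (by nlinarith)

lemma tsum_lambert_pair {x q : ℂ} (hx : ‖x‖ = 1) (hq : ‖q‖ < 1) :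
    ∑' p : ℕ × ℕ, (x * q ^ (p.1 + 1)) ^ (p.2 + 1) / ((p.2 : ℂ) + 1) = lambertSeries x q := by
  have hp := summable_lambert_pair hx hq
  have h3 := (Equiv.prodComm ℕ ℕ).tsum_eq
    fun p : ℕ × ℕ => (x * q ^ (p.1 + 1)) ^ (p.2 + 1) / ((p.2 : ℂ) + 1)
  simp only [Equiv.prodComm_apply] at h3
  rw [← h3, hp.prod_symm.tsum_prod, lambertSeries]
  refine tsum_congr fun m => ?_
  rw [← (hasSum_pow_mul_succ hq m).tsum_eq, ← tsum_mul_left]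
  refine tsum_congr fun n => ?_
  simp only [Prod.swap_prod_mk]
  rw [mul_pow, mul_div_right_comm]

lemma hasSum_log_one_sub {x q : ℂ} (hx : ‖x‖ = 1) (hq : ‖q‖ < 1) :
    HasSum (fun n : ℕ => log (1 - x * q ^ (n + 1))) (-lambertSeries x q) := by
  have hp := summable_lambert_pair hx hq
  have hlt : ∀ n : ℕ, ‖x * q ^ (n + 1)‖ < 1 := fun n => by
    rw [norm_mul, hx, one_mul, norm_pow]; exact pow_lt_one₀ (norm_nonneg _) hq n.succ_ne_zero
  have h1 : HasSum (fun n : ℕ => -log (1 - x * q ^ (n + 1))) (lambertSeries x q) := by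
    rw [← tsum_lambert_pair hx hq]
    refine HasSum.prod_fiberwise hp.hasSum fun n => ?_
    dsimp only
    exact hasSum_neg_log_one_sub (hlt n)
  have h4 := h1.neg
  simp only [neg_neg] at h4
  exact h4

lemma summable_lambertSeries {x q : ℂ} (hx : ‖x‖ = 1) (hq : ‖q‖ < 1) :
    Summable fun m : ℕ => x ^ (m + 1) / ((m : ℂ) + 1) * (q ^ (m + 1) / (1 - q ^ (m + 1))) := by
  have hp := (summable_lambert_pair hx hq).prod_symm.prod
  refine hp.congr fun m => ?_
  rw [← (hasSum_pow_mul_succ hq m).tsum_eq, ← tsum_mul_left]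
  refine tsum_congr fun n => ?_
  simp only [Prod.swap_prod_mk]
  rw [mul_pow]; ring

/-- The term n = 0 lies on the unit circle and is split off. For |q| > 1 the product starts at n =
1, so no such term appears in `logQPochhammer_of_one_lt_norm`. -/
lemma logQPochhammer_of_norm_lt_one {x q : ℂ} (hx : ‖x‖ = 1) (hq : ‖q‖ < 1) :
    logQPochhammer x q = log (1 - x) - lambertSeries x q := by
  have h := hasSum_log_one_sub hx hq
  rw [logQPochhammer, if_pos hq]
  have hs : Summable fun n : ℕ => log (1 - x * q ^ n) := (summable_nat_add_iff 1).1 h.summable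
  rw [hs.tsum_eq_zero_add, h.tsum_eq]
  simp [sub_eq_add_neg]

lemma logQPochhammer_of_one_lt_norm {x q : ℂ} (hx : ‖x‖ = 1) (hq : 1 < ‖q‖) :
    logQPochhammer x q = lambertSeries x q⁻¹ := by
  have hq' : ‖q⁻¹‖ < 1 := by rw [norm_inv]; exact inv_lt_one_of_one_lt₀ hq
  rw [logQPochhammer, if_neg hq.le.not_gt, (hasSum_log_one_sub hx hq').tsum_eq, neg_neg]

lemma norm_exp_two_pi_mul (y : ℂ) : ‖cexp (2 * Real.pi * I * y)‖ = Real.exp (-(2 * Real.pi * y.im)) := by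
  rw [norm_exp]; congr 1; simp

lemma norm_exp_two_pi_mul_lt_one {y : ℂ} (hy : 0 < y.im) : ‖cexp (2 * Real.pi * I * y)‖ < 1 := by
  rw [norm_exp_two_pi_mul, Real.exp_lt_one_iff]
  have := Real.pi_pos
  simp; positivity

lemma one_lt_norm_exp_two_pi_mul {y : ℂ} (hy : y.im < 0) : 1 < ‖cexp (2 * Real.pi * I * y)‖ := by
  rw [norm_exp_two_pi_mul, Real.one_lt_exp_iff]
  have := Real.pi_pos
  nlinarith

/-! ### The cotangent and the difference L_x(y) - L_x(-y). -/

/-- The partial fraction expansion of the cotangent, as a formula for `∑_l 1 / (l² - z²)`. -/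
lemma tsum_inv_sq_sub_sq {z : ℂ} (hz : 0 < z.im) :
    ∑' l : ℕ, 1 / (((l : ℂ) + 1) ^ 2 - z ^ 2) = Real.pi / (I * z) *
      (-(cexp (2 * Real.pi * I * z) / (1 - cexp (2 * Real.pi * I * z))) - 1 / 2 +
        I / (2 * Real.pi * z)) := by
  have hz0 : z ≠ 0 := by rintro rfl; simp at hz
  have hn : ∀ n : ℤ, z ≠ n := fun n h => by rw [h] at hz; simp at hz
  have hc := cot_series_rep (x := z) (fun ⟨n, h⟩ => hn n h.symm)
  have hq : 1 - cexp (2 * Real.pi * I * z) ≠ 0 := fun h => by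
    have := norm_exp_two_pi_mul_lt_one hz
    rw [← sub_eq_zero.1 h] at this
    simp at this
  have e1 : ∀ n : ℕ, 1 / (z - ((n + 1 : ℕ) : ℂ)) + 1 / (z + ((n + 1 : ℕ) : ℂ)) =
      -(2 * z) * (1 / (((n : ℂ) + 1) ^ 2 - z ^ 2)) := fun n => by
    have h1 : z - ((n : ℂ) + 1) ≠ 0 := sub_ne_zero.2 (by exact_mod_cast hn (n + 1))
    have h2 : z + ((n : ℂ) + 1) ≠ 0 := by
      rw [← sub_neg_eq_add]; exact sub_ne_zero.2 (by exact_mod_cast hn (-(n + 1)))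
    have h3 : ((n : ℂ) + 1) ^ 2 - z ^ 2 ≠ 0 := by
      rw [show ((n : ℂ) + 1) ^ 2 - z ^ 2 = -((z - (n + 1)) * (z + (n + 1))) by ring]
      exact neg_ne_zero.2 (mul_ne_zero h1 h2)
    push_cast
    field_simp
    ring
  rw [tsum_pnat_eq_tsum_succ (f := fun n : ℕ => 1 / (z - (n : ℂ)) + 1 / (z + (n : ℂ)))] at hc
  simp_rw [e1] at hc
  rw [tsum_mul_left, Complex.cot_eq_exp_ratio,
    show 2 * I * (Real.pi * z) = 2 * Real.pi * I * z by ring] at hc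
  have hpi : (Real.pi : ℂ) ≠ 0 := by exact_mod_cast Real.pi_ne_zero
  have hsolve : ∑' l : ℕ, 1 / (((l : ℂ) + 1) ^ 2 - z ^ 2) =
      (1 / z - Real.pi * ((cexp (2 * Real.pi * I * z) + 1) /
        (I * (1 - cexp (2 * Real.pi * I * z))))) / (2 * z) := by
    rw [hc]; field_simp; ring
  rw [hsolve]
  generalize cexp (2 * Real.pi * I * z) = q at hq
  field_simp
  ring_nf

/-- The series `∑_{l ≥ 1} 1 / (l² - m² y²)`. -/
noncomputable def cotSum (y : ℂ) (m : ℕ) : ℂ := ∑' l : ℕ, 1 / (((l : ℂ) + 1) ^ 2 - (m * y) ^ 2)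

/-- The dilogarithm series `∑_{m ≥ 1} x ^ m / m²`. -/
noncomputable def dilogSeries (x : ℂ) : ℂ := ∑' m : ℕ, x ^ (m + 1) / ((m : ℂ) + 1) ^ 2

lemma summable_dilogSeries {x : ℂ} (hx : ‖x‖ = 1) :
    Summable fun m : ℕ => x ^ (m + 1) / ((m : ℂ) + 1) ^ 2 := by
  refine summable_inv_succ_sq.of_norm_bounded fun m => ?_
  have h3 : ‖(m : ℂ) + 1‖ = m + 1 := by exact_mod_cast Complex.norm_natCast (m + 1)
  rw [norm_div, norm_pow, norm_pow, hx, one_pow, h3]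

lemma neg_mem_doubleSector {M : ℝ} {y : ℂ} (hy : y ∈ doubleSector M) : -y ∈ doubleSector M := by
  simpa [doubleSector] using hy

lemma exists_direction_of_im_ne_zero {y : ℂ} (hy : y.im ≠ 0) :
    ∃ u : ℂ, 0 < u.re ∧ 0 < (u / y).re := by
  obtain ⟨u, v, κ, hu, hv, hκ, h⟩ := exists_direction (|y.re| / |y.im|)
  have hy0 : y ≠ 0 := by rintro rfl; simp at hy
  have hpos : 0 < κ / ‖y‖ := div_pos hκ (norm_pos_iff.2 hy0)
  have hmem : y ∈ doubleSector (|y.re| / |y.im|) :=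
    ⟨hy, by rw [div_mul_cancel₀ _ (abs_ne_zero.2 hy)]⟩
  rcases h y hmem with h | h
  · exact ⟨u, hu, hpos.trans_le h⟩
  · exact ⟨v, hv, hpos.trans_le h⟩

lemma linear_ne_zero {y : ℂ} (hy : y.im ≠ 0) (l m : ℕ) : (l : ℂ) + 1 + m * y ≠ 0 := by
  obtain ⟨u, hu, huy⟩ := exists_direction_of_im_ne_zero hy
  obtain ⟨δ, hδ, h⟩ := exists_norm_linear_ge hu huy
  intro h0
  have := h l m
  rw [h0, norm_zero] at this
  exact absurd this (not_le.2 (by positivity))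

lemma summable_cotSum {y : ℂ} (hy : y.im ≠ 0) (m : ℕ) :
    Summable fun l : ℕ => 1 / (((l : ℂ) + 1) ^ 2 - (m * y) ^ 2) := by
  obtain ⟨u, hu, huy⟩ := exists_direction_of_im_ne_zero hy
  obtain ⟨v, hv, hvy⟩ := exists_direction_of_im_ne_zero (y := -y) (by simpa using hy)
  obtain ⟨δ, hδ, h⟩ := exists_norm_linear_ge hu huy
  obtain ⟨δ', hδ', h'⟩ := exists_norm_linear_ge hv hvy
  refine (summable_inv_succ_sq.mul_left (1 / (δ * δ'))).of_norm_bounded fun l => ?_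
  have e : ((l : ℂ) + 1) ^ 2 - (m * y) ^ 2 = (l + 1 + m * y) * (l + 1 + m * -y) := by ring
  rw [e, norm_div, norm_one, norm_mul, div_mul_div_comm, one_mul]
  refine div_le_div_of_nonneg_left zero_le_one (by positivity) ?_
  have hm := m.cast_nonneg (α := ℝ)
  calc δ * δ' * ((l : ℝ) + 1) ^ 2 = (δ * (l + 1)) * (δ' * (l + 1)) := by ring
    _ ≤ (δ * (l + 1 + m)) * (δ' * (l + 1 + m)) := by
      have hlm : (l : ℝ) + 1 ≤ l + 1 + m := by linarith
      exact mul_le_mul (mul_le_mul_of_nonneg_left hlm hδ.le)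
        (mul_le_mul_of_nonneg_left hlm hδ'.le) (by positivity) (by positivity)
    _ ≤ _ := mul_le_mul (h l m) (h' l m) (by positivity) (norm_nonneg _)

/-- The odd part in y is again a difference of consecutive terms in m. This allows the summation by
parts to be undone after summing over l. -/
lemma laplaceTerm_sub_neg {y : ℂ} (hy : y.im ≠ 0) (l m : ℕ) :
    laplaceTerm y l m - laplaceTerm (-y) l m =
      2 * y * (1 / (((l : ℂ) + 1) ^ 2 - (m * y) ^ 2) -
        1 / (((l : ℂ) + 1) ^ 2 - ((m + 1 : ℕ) * y) ^ 2)) := by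
  have hny : (-y).im ≠ 0 := by simpa using hy
  have h0 : (l : ℂ) + 1 ≠ 0 := by exact_mod_cast l.succ_ne_zero
  have h1 := linear_ne_zero hy l m
  have h2 := linear_ne_zero hy l (m + 1)
  have h3 := linear_ne_zero hny l m
  have h4 := linear_ne_zero hny l (m + 1)
  have e : ∀ n : ℕ, ((l : ℂ) + 1) ^ 2 - (n * y) ^ 2 = (l + 1 + n * y) * (l + 1 + n * -y) :=
    fun n => by ring
  rw [e, e, laplaceTerm, laplaceTerm]
  push_cast at h2 h4 ⊢
  generalize (l : ℂ) + 1 = L at *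
  generalize (m : ℂ) = k at *
  simp only [mul_neg, ← sub_eq_add_neg, add_mul k 1, one_mul] at h2 h3 h4 ⊢
  generalize k * y = b at *
  have k1 := mul_ne_zero (mul_ne_zero h0 h1) h2
  have k2 := mul_ne_zero (mul_ne_zero h0 h3) h4
  have k3 := mul_ne_zero h1 h3
  have k4 := mul_ne_zero h2 h4
  rw [div_sub_div _ _ k1 k2, div_sub_div _ _ k3 k4, mul_div_assoc',
    div_eq_div_iff (mul_ne_zero k1 k2) (mul_ne_zero k3 k4)]
  ring

/-- Absolute convergence of the double series allows the sum over l to be taken first, where it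
produces `cotSum`. Summability in m is returned as well, since `tsum_pow_mul_sub_succ` needs it. -/
lemma laplaceSeries_sub_neg {x y : ℂ} (hx : ‖x‖ = 1) (hy : y.im ≠ 0) :
    laplaceSeries x y - laplaceSeries x (-y) = 2 * y * (x / (1 - x)) *
      (Real.pi ^ 2 / 6 - ∑' m : ℕ, x ^ m * (cotSum y m - cotSum y (m + 1))) ∧
    Summable fun m : ℕ => x ^ m * (cotSum y m - cotSum y (m + 1)) := by
  have hny : (-y).im ≠ 0 := by simpa using hy
  have hy0 : y ≠ 0 := by rintro rfl; simp at hy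
  obtain ⟨u, hu, huy⟩ := exists_direction_of_im_ne_zero hy
  obtain ⟨v, hv, hvy⟩ := exists_direction_of_im_ne_zero hny
  have s1 := summable_laplaceTerm hx hu huy
  have s2 := summable_laplaceTerm hx hv hvy
  have s3 := s1.sub s2
  have hrow : ∀ m : ℕ, ∑' l : ℕ, (x ^ m * laplaceTerm y l m - x ^ m * laplaceTerm (-y) l m) =
      2 * y * (x ^ m * (cotSum y m - cotSum y (m + 1))) := fun m => by
    rw [cotSum, cotSum, ← (summable_cotSum hy m).tsum_sub (summable_cotSum hy (m + 1)),
      ← tsum_mul_left, ← tsum_mul_left]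
    refine tsum_congr fun l => ?_
    rw [← mul_sub, laplaceTerm_sub_neg hy]
    ring
  have s4 : Summable fun m : ℕ => 2 * y * (x ^ m * (cotSum y m - cotSum y (m + 1))) := by
    refine s3.prod_symm.prod.congr fun m => ?_
    simp only [Prod.swap_prod_mk]
    exact hrow m
  have s5 : Summable fun m : ℕ => x ^ m * (cotSum y m - cotSum y (m + 1)) :=
    (summable_mul_left_iff (mul_ne_zero two_ne_zero hy0)).1 s4
  refine ⟨?_, s5⟩
  have hswap : ∑' p : ℕ × ℕ, (x ^ p.2 * laplaceTerm y p.1 p.2 - x ^ p.2 * laplaceTerm (-y) p.1 p.2) =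
      2 * y * ∑' m : ℕ, x ^ m * (cotSum y m - cotSum y (m + 1)) := by
    have h3 := (Equiv.prodComm ℕ ℕ).tsum_eq
      fun p : ℕ × ℕ => x ^ p.2 * laplaceTerm y p.1 p.2 - x ^ p.2 * laplaceTerm (-y) p.1 p.2
    simp only [Equiv.prodComm_apply] at h3
    rw [← h3, s3.prod_symm.tsum_prod, ← tsum_mul_left]
    refine tsum_congr fun m => ?_
    simp only [Prod.swap_prod_mk]
    exact hrow m
  rw [s1.tsum_sub s2] at hswap
  rw [laplaceSeries, laplaceSeries]
  linear_combination (-(x / (1 - x))) * hswap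

/-- Summation by parts for a conditionally convergent power series on the unit circle. -/
lemma tsum_pow_mul_sub_succ {x Λ : ℂ} {a : ℕ → ℂ} (hx : ‖x‖ = 1)
    (ha : Tendsto a atTop (𝓝 0)) (hs : Summable fun m : ℕ => x ^ m * (a m - a (m + 1)))
    (hΛ : Tendsto (fun M => ∑ m ∈ Finset.range M, x ^ (m + 1) * a (m + 1)) atTop (𝓝 Λ)) :
    ∑' m : ℕ, x ^ m * (a m - a (m + 1)) = a 0 + (1 - 1 / x) * Λ := by
  have hx0 : x ≠ 0 := by rintro rfl; simp at hx
  have hfin : ∀ M : ℕ, ∑ m ∈ Finset.range M, x ^ m * (a m - a (m + 1)) =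
      a 0 + (1 - 1 / x) * (∑ m ∈ Finset.range M, x ^ (m + 1) * a (m + 1)) - x ^ M * a M := by
    intro M
    induction M with
    | zero => simp
    | succ M ih =>
      rw [Finset.sum_range_succ, Finset.sum_range_succ, ih, pow_succ]
      field_simp
      ring
  have h0 : Tendsto (fun M => x ^ M * a M) atTop (𝓝 0) := by
    rw [tendsto_zero_iff_norm_tendsto_zero] at ha ⊢
    simpa [norm_pow, hx] using ha
  have h1 := ((hΛ.const_mul (1 - 1 / x)).const_add (a 0)).sub h0
  rw [sub_zero] at h1
  exact tendsto_nhds_unique hs.hasSum.tendsto_sum_nat (h1.congr fun M => (hfin M).symm)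

lemma cotSum_zero (y : ℂ) : cotSum y 0 = Real.pi ^ 2 / 6 := by
  simpa [cotSum] using hasSum_inv_succ_sq.tsum_eq

/-- The cotangent expansion at z = (m + 1) y. Weighted by x^(m+1), its three terms sum to the
Lambert series, to log (1 - x) and to the dilogarithm. -/
lemma cotSum_succ {y : ℂ} (hy : 0 < y.im) (m : ℕ) :
    cotSum y (m + 1) = Real.pi / (I * y) *
      (-(1 / ((m : ℂ) + 1) * (cexp (2 * Real.pi * I * y) ^ (m + 1) /
          (1 - cexp (2 * Real.pi * I * y) ^ (m + 1)))) - 1 / 2 * (1 / ((m : ℂ) + 1)) +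
        I / (2 * Real.pi * y) * (1 / ((m : ℂ) + 1) ^ 2)) := by
  have hm : (0 : ℝ) < m + 1 := by positivity
  have him : 0 < (((m + 1 : ℕ) : ℂ) * y).im := by
    rw [← ofReal_natCast, im_ofReal_mul]; push_cast; positivity
  have hm0 : (m : ℂ) + 1 ≠ 0 := by exact_mod_cast m.succ_ne_zero
  have hy0 : y ≠ 0 := by rintro rfl; simp at hy
  have hpi : (Real.pi : ℂ) ≠ 0 := by exact_mod_cast Real.pi_ne_zero
  rw [cotSum, tsum_inv_sq_sub_sq him, ← Complex.exp_nat_mul,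
    show ((m + 1 : ℕ) : ℂ) * (2 * Real.pi * I * y) = 2 * Real.pi * I * ((m + 1 : ℕ) * y) by ring]
  generalize cexp (2 * Real.pi * I * ((m + 1 : ℕ) * y)) / (1 - cexp (2 * Real.pi * I *
    ((m + 1 : ℕ) * y))) = ε
  push_cast
  field_simp

/-- Summation by parts evaluates the series in `laplaceSeries_sub_neg`. Its boundary term `cotSum y
0` = π²/6 cancels the explicit π²/6 there, and the Lambert series is left to be solved for. -/
lemma logQPochhammer_exp_of_im_pos {x y : ℂ} (hx : ‖x‖ = 1) (hx1 : x ≠ 1) (hy : 0 < y.im) :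
    logQPochhammer x (cexp (2 * Real.pi * I * y)) = 1 / 2 * log (1 - x) -
      I / (2 * Real.pi) * dilogSeries x / y +
      I / (2 * Real.pi) * (laplaceSeries x y - laplaceSeries x (-y)) := by
  have hq := norm_exp_two_pi_mul_lt_one hy
  have hy0 : y ≠ 0 := by rintro rfl; simp at hy
  have hx0 : x ≠ 0 := by rintro rfl; simp at hx
  have hx1' : 1 - x ≠ 0 := sub_ne_zero.2 hx1.symm
  have hpi : (Real.pi : ℂ) ≠ 0 := by exact_mod_cast Real.pi_ne_zero
  set q := cexp (2 * Real.pi * I * y) with hqdef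
  have t1 := (summable_lambertSeries hx hq).hasSum.tendsto_sum_nat
  have t2 := tendsto_sum_pow_div_succ hx hx1
  have t3 := (summable_dilogSeries hx).hasSum.tendsto_sum_nat
  have hΛ : Tendsto (fun M => ∑ m ∈ Finset.range M, x ^ (m + 1) * cotSum y (m + 1)) atTop
      (𝓝 (Real.pi / (I * y) * (-lambertSeries x q - 1 / 2 * (-log (1 - x)) +
        I / (2 * Real.pi * y) * dilogSeries x))) := by
    refine (((t1.neg.sub (t2.const_mul (1 / 2))).add
      (t3.const_mul (I / (2 * Real.pi * y)))).const_mul (Real.pi / (I * y))).congr fun M => ?_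
    rw [Finset.mul_sum, Finset.mul_sum, ← Finset.sum_neg_distrib, ← Finset.sum_sub_distrib,
      ← Finset.sum_add_distrib, Finset.mul_sum]
    refine Finset.sum_congr rfl fun m _ => ?_
    rw [cotSum_succ hy, ← hqdef]
    ring
  have ha : Tendsto (cotSum y) atTop (𝓝 0) := by
    rw [← tendsto_add_atTop_iff_nat 1]
    have z1 := (summable_lambertSeries hx hq).tendsto_atTop_zero
    have z2 : Tendsto (fun m : ℕ => 1 / ((m : ℂ) + 1)) atTop (𝓝 0) :=
      tendsto_one_div_add_atTop_nhds_zero_nat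
    -- Since |x| = 1, removing the factor x^(m+1) does not change norms.
    have z1' : Tendsto (fun m : ℕ => 1 / ((m : ℂ) + 1) * (q ^ (m + 1) / (1 - q ^ (m + 1))))
        atTop (𝓝 0) := by
      rw [tendsto_zero_iff_norm_tendsto_zero] at z1 ⊢
      refine z1.congr fun m => ?_
      rw [norm_mul, norm_div (x ^ _), norm_pow x, hx, one_pow, norm_mul (1 / _), norm_div 1, norm_one]
    have h := (((z1'.neg.sub (z2.const_mul (1 / 2))).add
      ((z2.pow 2).const_mul (I / (2 * Real.pi * y)))).const_mul (Real.pi / (I * y)))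
    simp only [neg_zero, mul_zero, sub_zero, ne_eq, OfNat.ofNat_ne_zero, not_false_eq_true,
      zero_pow, add_zero] at h
    refine h.congr fun m => ?_
    rw [cotSum_succ hy, ← hqdef]
    simp only [one_div, inv_pow]
  obtain ⟨h1, h2⟩ := laplaceSeries_sub_neg hx hy.ne'
  rw [tsum_pow_mul_sub_succ hx ha h2 hΛ, cotSum_zero] at h1
  rw [h1, logQPochhammer_of_norm_lt_one hx hq]
  field_simp
  ring

/-- The `q`-Pochhammer symbol at a point `x ≠ 1` of the unit circle as a combination of Laplace
transforms, on both sides of the real axis. -/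
lemma logQPochhammer_exp {x y : ℂ} (hx : ‖x‖ = 1) (hx1 : x ≠ 1) (hy : y.im ≠ 0) :
    logQPochhammer x (cexp (2 * Real.pi * I * y)) = 1 / 2 * log (1 - x) -
      I / (2 * Real.pi) * dilogSeries x / y +
      I / (2 * Real.pi) * (laplaceSeries x y - laplaceSeries x (-y)) := by
  rcases lt_or_gt_of_ne hy with h | h
  · have hn : 0 < (-y).im := by simpa using h
    -- At -y the symbol is log (1 - x) minus the same Lambert series that gives the symbol at y.
    -- Apart from ½ log (1 - x) the right side is odd in y, so the formula keeps its form.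
    have h1 := logQPochhammer_exp_of_im_pos hx hx1 hn
    have hinv : cexp (2 * Real.pi * I * -y) = (cexp (2 * Real.pi * I * y))⁻¹ := by
      rw [mul_neg, Complex.exp_neg]
    rw [logQPochhammer_of_norm_lt_one hx (norm_exp_two_pi_mul_lt_one hn), hinv, neg_neg, div_neg] at h1
    rw [logQPochhammer_of_one_lt_norm hx (one_lt_norm_exp_two_pi_mul h)]
    linear_combination -h1
  · exact logQPochhammer_exp_of_im_pos hx hx1 h

/-! ### Uniqueness of Borel-Laplace sums -/

/-- The intersection of two domains star-shaped around 0 is again star-shaped, hence connected, so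
the identity theorem applies. -/
lemma IsBorelContinuation.eqOn {a : ℕ → ℂ} {U V : Set ℂ} {B C : ℂ → ℂ}
    (hB : IsBorelContinuation a U B) (hC : IsBorelContinuation a V C) (h0 : (0 : ℂ) ∈ U ∩ V) :
    Set.EqOn B C (U ∩ V) := by
  have hUV : IsOpen (U ∩ V) := hB.isOpen.inter hC.isOpen
  refine AnalyticOnNhd.eqOn_of_preconnected_of_eventuallyEq
    ((hB.differentiableOn.mono Set.inter_subset_left).analyticOnNhd hUV)
    ((hC.differentiableOn.mono Set.inter_subset_right).analyticOnNhd hUV)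
    ((hB.starConvex.inter hC.starConvex).isPathConnected h0).isConnected.isPreconnected h0 ?_
  filter_upwards [hB.hasSum, hC.hasSum] with z h1 h2 using h1.unique h2

lemma HasLaplaceSum.unique {a : ℕ → ℂ} {θ : ℝ} {y v w : ℂ} (hv : HasLaplaceSum a θ y v)
    (hw : HasLaplaceSum a θ y w) : v = w := by
  obtain ⟨-, U, B, hB, hU, -, rfl⟩ := hv
  obtain ⟨-, V, C, hC, hV, -, rfl⟩ := hw
  have h0 : (0 : ℂ) ∈ U ∩ V := ⟨by simpa using hU 0 le_rfl, by simpa using hV 0 le_rfl⟩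
  refine setIntegral_congr_fun measurableSet_Ioi fun t ht => ?_
  rw [hB.eqOn hC h0 ⟨hU t (le_of_lt ht), hV t (le_of_lt ht)⟩]

lemma HasBorelLaplaceSum.unique {φ : LaurentSeries ℂ} {θ : ℝ} {y v w : ℂ}
    (hv : HasBorelLaplaceSum φ θ y v) (hw : HasBorelLaplaceSum φ θ y w) : v = w :=
  sub_left_injective (HasLaplaceSum.unique hv hw)

lemma HasMedianSum.unique {φ : LaurentSeries ℂ} {θ : ℝ} {y v w : ℂ}
    (hv : HasMedianSum φ θ y v) (hw : HasMedianSum φ θ y w) : v = w := by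
  obtain ⟨vp, vm, hvp, hvm, rfl⟩ := hv
  obtain ⟨wp, wm, hwp, hwm, rfl⟩ := hw
  obtain ⟨ε, h1, h2⟩ := (hvp.and hwp).exists
  obtain ⟨δ, h3, h4⟩ := (hvm.and hwm).exists
  rw [h1.unique h2, h3.unique h4]

/-! ### Asymptotic expansions in Laurent series -/

/-- Partial sums of two series start at different orders. A common lower limit is needed before they
can be subtracted. -/
lemma LaurentSeries.sum_Ico_order_eq (φ : LaurentSeries ℂ) {L : ℤ} (hL : ∀ m < L, φ.coeff m = 0)
    (n : ℤ) (y : ℂ) : ∑ m ∈ Finset.Ico φ.order n, φ.coeff m * y ^ m =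
      ∑ m ∈ Finset.Ico L n, φ.coeff m * y ^ m := by
  have key : ∀ K : ℤ, (∀ m < K, φ.coeff m = 0) → ∑ m ∈ Finset.Ico K n, φ.coeff m * y ^ m =
      ∑ m ∈ Finset.Ico (min φ.order L) n, φ.coeff m * y ^ m ∨ ¬ min φ.order L ≤ K := fun K hK => by
    by_cases h : min φ.order L ≤ K
    · left
      refine Finset.sum_subset (Finset.Ico_subset_Ico_left h) fun m hm hm' => ?_
      rw [Finset.mem_Ico] at hm hm'
      rw [hK m (by by_contra h'; exact hm' ⟨not_lt.1 h', hm.2⟩), zero_mul]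
    · exact Or.inr h
  rw [(key φ.order fun m hm => HahnSeries.coeff_eq_zero_of_lt_order hm).resolve_right
    (not_not.2 (min_le_left _ _)), (key L hL).resolve_right (not_not.2 (min_le_right _ _))]

lemma HasAsymptoticExpansionWithin.unique {f : ℂ → ℂ} {S : Set ℂ} {φ ψ : LaurentSeries ℂ}
    (h0 : (0 : ℂ) ∉ S) [NeBot (𝓝[S] (0 : ℂ))] (hφ : HasAsymptoticExpansionWithin f S φ)
    (hψ : HasAsymptoticExpansionWithin f S ψ) : φ = ψ := by
  by_contra hne
  have hne' : φ - ψ ≠ 0 := sub_ne_zero.2 hne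
  -- Truncating both expansions just after the first exponent where they differ leaves c y^m₀ =
  -- O(y^(m₀+1)) with c ≠ 0.
  set m₀ := (φ - ψ).order with hm₀
  set L := min (min φ.order ψ.order) m₀ with hLdef
  have hLφ : ∀ m < L, φ.coeff m = 0 := fun m hm =>
    HahnSeries.coeff_eq_zero_of_lt_order (by omega)
  have hLψ : ∀ m < L, ψ.coeff m = 0 := fun m hm =>
    HahnSeries.coeff_eq_zero_of_lt_order (by omega)
  have hc : (φ - ψ).coeff m₀ ≠ 0 := HahnSeries.coeff_order_eq_zero.not.2 hne'
  have hO := (hψ (m₀ + 1)).sub (hφ (m₀ + 1))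
  have hdiff : ∀ y : ℂ, (f y - ∑ m ∈ Finset.Ico ψ.order (m₀ + 1), ψ.coeff m * y ^ m) -
      (f y - ∑ m ∈ Finset.Ico φ.order (m₀ + 1), φ.coeff m * y ^ m) =
      (φ - ψ).coeff m₀ * y ^ m₀ := fun y => by
    rw [ψ.sum_Ico_order_eq hLψ, φ.sum_Ico_order_eq hLφ, sub_sub_sub_cancel_left,
      ← Finset.sum_sub_distrib, Finset.sum_eq_single m₀]
    · rw [HahnSeries.coeff_sub, sub_mul]
    · intro m hm hmne
      have hlt : m < m₀ := by rw [Finset.mem_Ico] at hm; omega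
      have := HahnSeries.coeff_eq_zero_of_lt_order (hm₀ ▸ hlt)
      rw [← sub_mul, ← HahnSeries.coeff_sub, this, zero_mul]
    · intro h
      exact absurd (Finset.mem_Ico.2 ⟨min_le_right _ _, by omega⟩) h
  simp only [hdiff] at hO
  obtain ⟨C, hC⟩ := hO.bound
  have hev : ∀ᶠ y in 𝓝[S] (0 : ℂ), ‖(φ - ψ).coeff m₀‖ ≤ C * ‖y‖ := by
    filter_upwards [hC, self_mem_nhdsWithin] with y hy hyS
    have hy0 : y ≠ 0 := fun h => h0 (h ▸ hyS)
    have hpos : 0 < ‖y ^ m₀‖ := norm_pos_iff.2 (zpow_ne_zero _ hy0)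
    rw [norm_mul, zpow_add_one₀ hy0, norm_mul, mul_left_comm, mul_comm] at hy
    exact le_of_mul_le_mul_left hy hpos
  have hlim : Tendsto (fun y : ℂ => C * ‖y‖) (𝓝[S] 0) (𝓝 0) := by
    have : Tendsto (fun y : ℂ => C * ‖y‖) (𝓝 0) (𝓝 (C * ‖(0 : ℂ)‖)) :=
      (continuous_const.mul continuous_norm).tendsto 0
    simpa using this.mono_left nhdsWithin_le_nhds
  exact hc (norm_le_zero_iff.1 (ge_of_tendsto hlim hev))

lemma HasAsymptoticExpansionUpper.unique {f : ℂ → ℂ} {φ ψ : LaurentSeries ℂ}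
    (hφ : HasAsymptoticExpansionUpper f φ) (hψ : HasAsymptoticExpansionUpper f ψ) : φ = ψ := by
  -- The degenerate sector M = 0, the imaginary half-axis, already determines the expansion.
  have : NeBot (𝓝[{y : ℂ | 0 < y.im ∧ |y.re| ≤ 0 * y.im}] (0 : ℂ)) := by
    refine mem_closure_iff_nhdsWithin_neBot.1 (Metric.mem_closure_iff.2 fun ε hε => ?_)
    exact ⟨(ε / 2 : ℝ) * I, by simp; positivity, by simp [abs_of_pos hε]; linarith⟩
  exact HasAsymptoticExpansionWithin.unique (by simp) (hφ 0) (hψ 0)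

lemma HasAsymptoticExpansionLower.unique {f : ℂ → ℂ} {φ ψ : LaurentSeries ℂ}
    (hφ : HasAsymptoticExpansionLower f φ) (hψ : HasAsymptoticExpansionLower f ψ) : φ = ψ := by
  have : NeBot (𝓝[{y : ℂ | y.im < 0 ∧ |y.re| ≤ 0 * -y.im}] (0 : ℂ)) := by
    refine mem_closure_iff_nhdsWithin_neBot.1 (Metric.mem_closure_iff.2 fun ε hε => ?_)
    exact ⟨(-(ε / 2) : ℝ) * I, by simp; positivity, by simp [abs_of_pos hε]; linarith⟩
  exact HasAsymptoticExpansionWithin.unique (by simp) (hφ 0) (hψ 0)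

/-- The Laurent series `a y⁻¹ + b + ∑_{n ≥ 0} c_n y ^ (n + 1)`. -/
noncomputable def simplePoleSeries (a b : ℂ) (c : ℕ → ℂ) : LaurentSeries ℂ :=
  HahnSeries.ofSuppBddBelow
    (fun m : ℤ => if m = -1 then a else if m = 0 then b else if 0 < m then c (m - 1).toNat else 0)
    ⟨-1, fun m hm => by
      by_contra h
      simp [show m ≠ -1 by omega, show m ≠ 0 by omega, show ¬ 0 < m by omega] at hm⟩

section simplePoleSeries

variable (a b : ℂ) (c : ℕ → ℂ)

lemma simplePoleSeries_coeff_neg_one : (simplePoleSeries a b c).coeff (-1) = a := by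
  simp [simplePoleSeries]

lemma simplePoleSeries_coeff_zero : (simplePoleSeries a b c).coeff 0 = b := by
  simp [simplePoleSeries]

lemma simplePoleSeries_coeff_succ (n : ℕ) :
    (simplePoleSeries a b c).coeff ((n : ℤ) + 1) = c n := by
  simp [simplePoleSeries, show (n : ℤ) + 1 ≠ -1 by omega, show (n : ℤ) + 1 ≠ 0 by omega,
    show (0 : ℤ) < n + 1 by omega]

lemma simplePoleSeries_coeff_of_lt {m : ℤ} (hm : m < -1) :
    (simplePoleSeries a b c).coeff m = 0 := by
  simp [simplePoleSeries, show m ≠ -1 by omega, show m ≠ 0 by omega, show ¬ 0 < m by omega]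

lemma simplePoleSeries_sum_Ico (n : ℕ) (y : ℂ) :
    ∑ m ∈ Finset.Ico (simplePoleSeries a b c).order ((n : ℤ) + 1),
      (simplePoleSeries a b c).coeff m * y ^ m =
      a / y + b + ∑ j ∈ Finset.range n, c j * y ^ (j + 1) := by
  -- The order is not always -1 (the coefficient a may vanish, and the zero series has order 0), so
  -- the sum is moved to the fixed lower limit -1.
  rw [(simplePoleSeries a b c).sum_Ico_order_eq
    (fun m hm => simplePoleSeries_coeff_of_lt a b c hm)]
  have h : ∑ m ∈ Finset.Ico (-1 : ℤ) ((n : ℤ) + 1), (simplePoleSeries a b c).coeff m * y ^ m =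
      ∑ k ∈ Finset.range (n + 2),
        (simplePoleSeries a b c).coeff ((k : ℤ) - 1) * y ^ ((k : ℤ) - 1) := by
    symm
    refine Finset.sum_nbij (fun k : ℕ => (k : ℤ) - 1) ?_ ?_ ?_ fun k _ => rfl
    · intro k hk
      rw [Finset.mem_range] at hk
      exact Finset.mem_Ico.2 ⟨by omega, by omega⟩
    · intro k _ l _ h
      simp only at h
      omega
    · intro m hm
      rw [Finset.coe_Ico, Set.mem_Ico] at hm
      exact ⟨(m + 1).toNat, by simp; omega, by simp; omega⟩
  rw [h, Finset.sum_range_succ', Finset.sum_range_succ']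
  have e0 : ((0 : ℕ) : ℤ) - 1 = -1 := by norm_num
  have e1 : ((0 + 1 : ℕ) : ℤ) - 1 = 0 := by norm_num
  have e2 : ∀ j : ℕ, ((j + 1 + 1 : ℕ) : ℤ) - 1 = (j : ℤ) + 1 := fun j => by push_cast; ring
  simp_rw [e2]
  rw [e0, e1, simplePoleSeries_coeff_neg_one, simplePoleSeries_coeff_zero]
  simp_rw [simplePoleSeries_coeff_succ]
  rw [zpow_zero, zpow_neg_one, mul_one, div_eq_mul_inv]
  have e3 : ∀ j : ℕ, y ^ ((j : ℤ) + 1) = y ^ (j + 1) := fun j => by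
    rw [← zpow_natCast]; push_cast; rfl
  simp_rw [e3]
  ring

lemma simplePoleSeries_sum_Icc (y : ℂ) :
    ∑ m ∈ Finset.Icc (simplePoleSeries a b c).order 0, (simplePoleSeries a b c).coeff m * y ^ m =
      a / y + b := by
  have h := simplePoleSeries_sum_Ico a b c 0 y
  simp only [Finset.range_zero, Finset.sum_empty, add_zero] at h
  rw [← h]
  refine Finset.sum_congr ?_ fun _ _ => rfl
  ext m
  simp only [Finset.mem_Icc, Finset.mem_Ico, Nat.cast_zero]
  omega

lemma hasAsymptoticExpansionWithin_simplePoleSeries {f : ℂ → ℂ} {S : Set ℂ} (h0 : (0 : ℂ) ∉ S)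
    (h : ∀ n : ℕ, ∃ C : ℝ, ∀ y ∈ S,
      ‖f y - (a / y + b + ∑ j ∈ Finset.range n, c j * y ^ (j + 1))‖ ≤ C * ‖y‖ ^ (n + 1)) :
    HasAsymptoticExpansionWithin f S (simplePoleSeries a b c) := by
  have hnat : ∀ n : ℕ, (fun y : ℂ => f y - ∑ m ∈ Finset.Ico (simplePoleSeries a b c).order
      ((n : ℤ) + 1), (simplePoleSeries a b c).coeff m * y ^ m)
      =O[𝓝[S] 0] (fun y : ℂ => y ^ ((n : ℤ) + 1)) := fun n => by
    obtain ⟨C, hC⟩ := h n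
    refine IsBigO.of_bound C ?_
    filter_upwards [self_mem_nhdsWithin] with y hy
    rw [simplePoleSeries_sum_Ico]
    refine (hC y hy).trans_eq ?_
    rw [norm_zpow]
    norm_cast
  -- The definition asks for every integer n. Below 1, each step down drops at most one term, itself
  -- O(y^(n-1)).
  have hdown : ∀ n : ℤ, n ≤ 1 → (fun y : ℂ => f y - ∑ m ∈ Finset.Ico
      (simplePoleSeries a b c).order n, (simplePoleSeries a b c).coeff m * y ^ m)
      =O[𝓝[S] 0] (fun y : ℂ => y ^ n) := by
    refine Int.leInductionDown (by simpa using hnat 0) fun n _ ih => ?_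
    have hO : (fun y : ℂ => y ^ n) =O[𝓝[S] 0] (fun y : ℂ => y ^ (n - 1)) := by
      refine IsBigO.of_bound 1 ?_
      filter_upwards [self_mem_nhdsWithin, mem_nhdsWithin_of_mem_nhds
        (Metric.ball_mem_nhds (0 : ℂ) one_pos)] with y hy hy1
      have hy0 : y ≠ 0 := fun h => h0 (h ▸ hy)
      have e : y ^ n = y ^ (n - 1) * y := by rw [← zpow_add_one₀ hy0]; ring_nf
      rw [e, norm_mul, mul_comm]
      gcongr
      simpa using (mem_ball_zero_iff.1 hy1).le
    by_cases ho : (simplePoleSeries a b c).order ≤ n - 1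
    · have e : ∀ y : ℂ, f y - ∑ m ∈ Finset.Ico (simplePoleSeries a b c).order (n - 1),
          (simplePoleSeries a b c).coeff m * y ^ m =
          (f y - ∑ m ∈ Finset.Ico (simplePoleSeries a b c).order n,
            (simplePoleSeries a b c).coeff m * y ^ m) +
          (simplePoleSeries a b c).coeff (n - 1) * y ^ (n - 1) := fun y => by
        have hI : Finset.Ico (simplePoleSeries a b c).order n =
            insert (n - 1) (Finset.Ico (simplePoleSeries a b c).order (n - 1)) := by
          ext m; simp only [Finset.mem_insert, Finset.mem_Ico]; omega
        rw [hI, Finset.sum_insert (by simp)]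
        ring
      simp_rw [e]
      exact (ih.trans hO).add ((isBigO_refl _ _).const_mul_left _)
    · have hI : Finset.Ico (simplePoleSeries a b c).order (n - 1) =
          Finset.Ico (simplePoleSeries a b c).order n := by
        rw [Finset.Ico_eq_empty (by omega), Finset.Ico_eq_empty (by omega)]
      rw [hI]
      exact ih.trans hO
  intro n
  rcases le_or_gt n 1 with hn | hn
  · exact hdown n hn
  · obtain ⟨k, rfl⟩ : ∃ k : ℕ, n = (k : ℤ) + 1 := ⟨(n - 1).toNat, by omega⟩
    exact hnat k

end simplePoleSeries

/-! ### Character sums over the nontrivial roots of unity. -/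

/-- The sum `∑_{1 ≤ k < N} χ(k) F(ζ_N ^ k)`. -/
noncomputable def charSum {N : ℕ} (χ : DirichletCharacter ℂ N) (F : ℂ → ℂ) : ℂ :=
  ∑ k ∈ Finset.Ico 1 N, χ (k : ZMod N) * F (cexp (2 * Real.pi * I / N) ^ k)

/-- The `N`-th roots of unity other than `1`. -/
def nontrivialRoots (N : ℕ) : Set ℂ := {x : ℂ | x ^ N = 1 ∧ x ≠ 1}

lemma isPrimitiveRoot_zeta {N : ℕ} (hN : 2 ≤ N) :
    IsPrimitiveRoot (cexp (2 * Real.pi * I / N)) N :=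
  Complex.isPrimitiveRoot_exp N (by omega)

lemma zeta_pow_mem_nontrivialRoots {N : ℕ} (hN : 2 ≤ N) {k : ℕ} (hk : k ∈ Finset.Ico 1 N) :
    cexp (2 * Real.pi * I / N) ^ k ∈ nontrivialRoots N := by
  have h := isPrimitiveRoot_zeta hN
  rw [Finset.mem_Ico] at hk
  exact ⟨by rw [pow_right_comm, h.pow_eq_one, one_pow],
    h.pow_ne_one_of_pos_of_lt (by omega) hk.2⟩

lemma norm_eq_one_of_mem_nontrivialRoots {N : ℕ} (hN : 2 ≤ N) {x : ℂ}
    (hx : x ∈ nontrivialRoots N) : ‖x‖ = 1 :=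
  norm_eq_one_of_pow_eq_one hx.1 (by omega)

section charSum

variable {N : ℕ} (χ : DirichletCharacter ℂ N)

lemma charSum_congr (hN : 2 ≤ N) {F G : ℂ → ℂ} (h : ∀ x ∈ nontrivialRoots N, F x = G x) :
    charSum χ F = charSum χ G :=
  Finset.sum_congr rfl fun _ hk => by rw [h _ (zeta_pow_mem_nontrivialRoots hN hk)]

lemma charSum_add (F G : ℂ → ℂ) :
    charSum χ (fun x => F x + G x) = charSum χ F + charSum χ G := by
  simp [charSum, mul_add, Finset.sum_add_distrib]

lemma charSum_sub (F G : ℂ → ℂ) :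
    charSum χ (fun x => F x - G x) = charSum χ F - charSum χ G := by
  simp [charSum, mul_sub, Finset.sum_sub_distrib]

lemma charSum_mul_right (F : ℂ → ℂ) (c : ℂ) :
    charSum χ (fun x => F x * c) = charSum χ F * c := by
  simp [charSum, Finset.sum_mul, mul_assoc]

lemma charSum_mul_left (F : ℂ → ℂ) (c : ℂ) :
    charSum χ (fun x => c * F x) = c * charSum χ F := by
  simp [charSum, Finset.mul_sum, mul_left_comm]

/-- The substitution k ↦ N - k inverts ζ_N^k and multiplies χ(k) by χ(-1), whose square is 1. -/
lemma charSum_inv (F : ℂ → ℂ) : charSum χ (fun x => F x⁻¹) = χ (-1) * charSum χ F := by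
  unfold charSum
  rw [Finset.mul_sum]
  refine Finset.sum_nbij' (fun k => N - k) (fun k => N - k) ?_ ?_ ?_ ?_ ?_
  · intro k hk; rw [Finset.mem_Ico] at hk ⊢; omega
  · intro k hk; rw [Finset.mem_Ico] at hk ⊢; omega
  · intro k hk; rw [Finset.mem_Ico] at hk; omega
  · intro k hk; rw [Finset.mem_Ico] at hk; omega
  · intro k hk
    rw [Finset.mem_Ico] at hk
    have hN : N ≠ 0 := by omega
    have h1 : ((N - k : ℕ) : ZMod N) = -1 * (k : ZMod N) := by
      rw [Nat.cast_sub hk.2.le]; simp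
    have h2 : χ (-1) * χ (-1) = 1 := by rw [← map_mul]; simp
    have h3 : cexp (2 * Real.pi * I / N) ^ (N - k) = (cexp (2 * Real.pi * I / N) ^ k)⁻¹ := by
      refine eq_inv_of_mul_eq_one_left ?_
      rw [← pow_add, Nat.sub_add_cancel hk.2.le, (Complex.isPrimitiveRoot_exp N hN).pow_eq_one]
    rw [h1, map_mul, h3, ← mul_assoc, ← mul_assoc, h2, one_mul]

lemma charSum_tsum {F : ℂ → ℕ → ℂ} (hN : 2 ≤ N)
    (hF : ∀ x ∈ nontrivialRoots N, Summable (F x)) :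
    charSum χ (fun x => ∑' m, F x m) = ∑' m, charSum χ (fun x => F x m) := by
  unfold charSum
  rw [Summable.tsum_finsetSum]
  · exact Finset.sum_congr rfl fun k _ => tsum_mul_left.symm
  · exact fun k hk => (hF _ (zeta_pow_mem_nontrivialRoots hN hk)).mul_left _

lemma weightedF_eq_charSum (hN : 2 ≤ N) (y : ℂ) :
    weightedF χ y = charSum χ fun x => logQPochhammer x (cexp (2 * Real.pi * I * y)) := by
  have : Nontrivial (ZMod N) := ZMod.nontrivial_iff.2 (by omega)
  have hI : Finset.Icc 1 N = insert N (Finset.Ico 1 N) := by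
    ext m; simp only [Finset.mem_Icc, Finset.mem_insert, Finset.mem_Ico]; omega
  have h0 : χ ((N : ℕ) : ZMod N) = 0 := by
    rw [ZMod.natCast_self]; exact MulChar.map_nonunit _ not_isUnit_zero
  rw [weightedF, hI, Finset.sum_insert (by simp), h0, zero_mul, zero_add]
  rfl

/-- The values `χ(k)` are determined by the power sums `∑_k χ(k) ζ_N ^ {km}`, `m ≥ 1`. -/
lemma exists_charSum_pow_ne_zero (hN : 2 ≤ N) : ∃ m : ℕ, charSum χ (fun x => x ^ (m + 1)) ≠ 0 := by
  by_contra! h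
  have hζ := isPrimitiveRoot_zeta hN
  set ζ := cexp (2 * Real.pi * I / N) with hζdef
  have hinj : Function.Injective fun i : Fin (N - 1) => ζ ^ ((i : ℕ) + 1) := fun i j hij => by
    have := hζ.pow_inj (by omega) (by omega) hij
    exact Fin.ext (by omega)
  -- Vandermonde with the distinct nodes ζ, …, ζ^(N-1). One factor of the node is absorbed into the
  -- vector so that the exponents start at 0; its first entry χ(1) ζ is nonzero.
  have hv := Matrix.eq_zero_of_forall_pow_sum_mul_pow_eq_zero
    (v := fun i : Fin (N - 1) => χ (((i : ℕ) + 1 : ℕ) : ZMod N) * ζ ^ ((i : ℕ) + 1)) hinj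
    fun j => by
      have hj := h j
      rw [charSum, Finset.sum_Ico_eq_sum_range, Finset.sum_range] at hj
      rw [← hj]
      refine Finset.sum_congr rfl fun i _ => ?_
      rw [add_comm 1, ← hζdef, pow_succ]
      ring
  have h0 := congrFun hv ⟨0, by omega⟩
  simp [hζ.ne_zero (by omega)] at h0

end charSum

/-! ### Lambert series near q = 0; 𝔣 is not a Laurent polynomial. -/

/-- After division by q^(n+1) the terms with m < n are zero and those with m > n tend to 0, so only
g n remains. -/
lemma tendsto_lambert_div_pow {g : ℕ → ℂ} {A : ℝ} (hg : ∀ m, ‖g m‖ ≤ A) {n : ℕ}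
    (hn : ∀ j < n, g j = 0) :
    Tendsto (fun q : ℂ => (∑' m : ℕ, g m * (q ^ (m + 1) / (1 - q ^ (m + 1)))) / q ^ (n + 1))
      (𝓝[≠] 0) (𝓝 (g n)) := by
  have hA : 0 ≤ A := (norm_nonneg _).trans (hg 0)
  have hlim := tendsto_tsum_of_dominated_convergence (𝓕 := 𝓝[≠] (0 : ℂ))
    -- The truncated subtraction m - n is harmless because g m = 0 for m < n. In the bound, 2 comes
    -- from |1 - q^(m+1)| ≥ 1/2 for |q| ≤ 1/2, and 2^n (1/2)^m is (1/2)^(m-n).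
    (f := fun q m => g m * (q ^ (m - n) / (1 - q ^ (m + 1))))
    (g := fun m => if m = n then g n else 0) (bound := fun m => A * (2 * (2 ^ n * (1 / 2) ^ m)))
    (((summable_geometric_two.mul_left _).mul_left _).mul_left _) (fun m => ?_) ?_
  · rw [tsum_ite_eq] at hlim
    refine hlim.congr' ?_
    filter_upwards [self_mem_nhdsWithin] with q hq
    have hq0 : q ≠ 0 := hq
    rw [← tsum_div_const]
    refine tsum_congr fun m => ?_
    rcases lt_or_ge m n with h | h
    · rw [hn m h]; simp
    · have e : q ^ (m + 1) = q ^ (m - n) * q ^ (n + 1) := by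
        rw [← pow_add]; congr 1; omega
      nth_rewrite 2 [e]
      field_simp
  · have hc : ContinuousAt (fun q : ℂ => g m * (q ^ (m - n) / (1 - q ^ (m + 1)))) 0 := by
      refine continuousAt_const.mul (ContinuousAt.div (by fun_prop) (by fun_prop) (by simp))
    have h := hc.tendsto.mono_left (nhdsWithin_le_nhds (s := {0}ᶜ))
    refine h.trans (le_of_eq (congrArg 𝓝 ?_))
    rcases lt_trichotomy m n with hm | rfl | hm
    · simp [hn m hm, hm.ne]
    · simp
    · simp [hm.ne', Nat.sub_ne_zero_of_lt hm]
  · filter_upwards [mem_nhdsWithin_of_mem_nhds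
      (Metric.ball_mem_nhds (0 : ℂ) (by norm_num : (0 : ℝ) < 1 / 2))] with q hq m
    have hq2 : ‖q‖ ≤ 1 / 2 := (mem_ball_zero_iff.1 hq).le
    rcases lt_or_ge m n with h | h
    · rw [hn m h, zero_mul, norm_zero]; positivity
    · have h1 : 1 / 2 ≤ ‖1 - q ^ (m + 1)‖ := by
        have h2 : ‖q ^ (m + 1)‖ ≤ 1 / 2 := by
          rw [norm_pow, pow_succ]
          exact (mul_le_of_le_one_left (norm_nonneg _)
            (pow_le_one₀ (norm_nonneg _) (hq2.trans (by norm_num)))).trans hq2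
        have h3 := norm_sub_norm_le (1 : ℂ) (q ^ (m + 1))
        rw [norm_one] at h3
        linarith
      rw [norm_mul, norm_div, norm_pow]
      refine mul_le_mul (hg m) ?_ (by positivity) hA
      rw [div_le_iff₀ (by linarith)]
      have h4 : (2 : ℝ) ^ n * (1 / 2) ^ m = (1 / 2) ^ (m - n) := by
        obtain ⟨k, rfl⟩ := Nat.exists_eq_add_of_le h
        rw [Nat.add_sub_cancel_left, pow_add, ← mul_assoc, ← mul_pow]; norm_num
      rw [h4]
      have h5 : ‖q‖ ^ (m - n) ≤ (1 / 2) ^ (m - n) := pow_le_pow_left₀ (norm_nonneg _) hq2 _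
      have h6 : (0 : ℝ) ≤ (1 / 2) ^ (m - n) := by positivity
      nlinarith

/-- A Lambert series with bounded coefficients which is constant near `0` vanishes identically. -/
lemma lambert_coeff_eq_zero {g : ℕ → ℂ} {A : ℝ} (hg : ∀ m, ‖g m‖ ≤ A) {K : ℂ}
    (hK : ∀ᶠ q in 𝓝[≠] (0 : ℂ), ∑' m : ℕ, g m * (q ^ (m + 1) / (1 - q ^ (m + 1))) = K) (n : ℕ) :
    g n = 0 := by
  -- Every term of a Lambert series vanishes at q = 0: the quotient by q has a limit, so the series
  -- tends to 0.
  have hK0 : K = 0 := by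
    have h1 := (tendsto_lambert_div_pow hg (n := 0) (by simp)).mul
      (tendsto_id.mono_left (nhdsWithin_le_nhds (a := (0 : ℂ)) (s := {0}ᶜ)))
    rw [mul_zero] at h1
    refine tendsto_nhds_unique (tendsto_const_nhds (f := 𝓝[≠] (0 : ℂ))) (h1.congr' ?_)
    filter_upwards [hK, self_mem_nhdsWithin] with q hq hq0
    have hq0' : q ≠ 0 := hq0
    rw [hq]
    simp [hq0']
  induction n using Nat.strong_induction_on with
  | _ n ih =>
    refine tendsto_nhds_unique (tendsto_lambert_div_pow hg ih)
      (tendsto_const_nhds.congr' ?_)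
    filter_upwards [hK] with q hq
    rw [hq, hK0, zero_div]

lemma exists_exp_two_pi_mul_eq {q : ℂ} (hq0 : q ≠ 0) (hq : ‖q‖ < 1) :
    ∃ y : ℂ, 0 < y.im ∧ cexp (2 * Real.pi * I * y) = q := by
  have hpi : (Real.pi : ℂ) ≠ 0 := by exact_mod_cast Real.pi_ne_zero
  have hexp : cexp (2 * Real.pi * I * (log q / (2 * Real.pi * I))) = q := by
    rw [mul_div_cancel₀ _ (by simp [hpi]), Complex.exp_log hq0]
  refine ⟨_, ?_, hexp⟩
  rw [← hexp, norm_exp_two_pi_mul, Real.exp_lt_one_iff] at hq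
  have := Real.two_pi_pos
  nlinarith

lemma weightedF_add_one {N : ℕ} (χ : DirichletCharacter ℂ N) (y : ℂ) :
    weightedF χ (y + 1) = weightedF χ y := by
  have h : cexp (2 * Real.pi * I * (y + 1)) = cexp (2 * Real.pi * I * y) := by
    rw [mul_add, mul_one, Complex.exp_add, Complex.exp_two_pi_mul_I, mul_one]
  simp only [weightedF, fkN, h]

/-- `𝔣` is not a Laurent polynomial on the upper half-plane. -/
lemma weightedF_ne_laurent_polynomial {N : ℕ} (hN : 2 ≤ N) (χ : DirichletCharacter ℂ N)
    (a b c : ℂ) : ¬ ∀ y : ℂ, 0 < y.im → weightedF χ y = a / y + b + c * y := by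
  intro h
  -- Comparing the values at y and y + 1 gives a = c y (y + 1). Two values of y then force a = c =
  -- 0.
  have hper : ∀ y : ℂ, 0 < y.im → a = c * (y * (y + 1)) := fun y hy => by
    have hy0 : y ≠ 0 := by rintro rfl; simp at hy
    have hy1 : y + 1 ≠ 0 := fun h0 => by
      have := congrArg Complex.im h0
      simp at this
      exact hy.ne' this
    have h1 := weightedF_add_one χ y
    rw [h y hy, h (y + 1) (by simpa using hy)] at h1
    field_simp at h1
    linear_combination -h1
  have h1 := hper I (by simp)
  have h2 := hper (2 * I) (by simp)
  have hc : c = 0 := by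
    have h3 : c * (-3 + I) = 0 := by linear_combination h1 - h2 - (3 * c) * I_sq
    refine (mul_eq_zero.1 h3).resolve_right fun h4 => ?_
    have := congrArg Complex.im h4
    simp at this
  have ha : a = 0 := by rw [h1, hc, zero_mul]
  -- With 𝔣 now constant, and every q in the punctured unit disc of the form e^{2πiy}, the Lambert
  -- series of 𝔣 is constant in q.
  have hlam : ∀ q : ℂ, q ≠ 0 → ‖q‖ < 1 →
      ∑' m : ℕ, charSum χ (fun x => x ^ (m + 1)) / ((m : ℂ) + 1) *
        (q ^ (m + 1) / (1 - q ^ (m + 1))) = charSum χ (fun x => log (1 - x)) - b := fun q hq0 hq => by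
    obtain ⟨y, hy, rfl⟩ := exists_exp_two_pi_mul_eq hq0 hq
    have h3 := h y hy
    rw [weightedF_eq_charSum χ hN, charSum_congr χ hN fun x hx => logQPochhammer_of_norm_lt_one
      (norm_eq_one_of_mem_nontrivialRoots hN hx) hq, charSum_sub, ha, hc] at h3
    have h4 := charSum_tsum χ hN fun x hx =>
      summable_lambertSeries (norm_eq_one_of_mem_nontrivialRoots hN hx) hq
    simp_rw [div_mul_eq_mul_div, mul_div_assoc, charSum_mul_right] at h4
    simp_rw [div_mul_eq_mul_div, mul_div_assoc]
    rw [← h4]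
    have h5 : (charSum χ fun x => lambertSeries x (cexp (2 * Real.pi * I * y))) =
        charSum χ (fun x => log (1 - x)) - b := by linear_combination -h3
    rw [← h5]
    refine charSum_congr χ hN fun x _ => ?_
    unfold lambertSeries
    refine tsum_congr fun m => ?_
    ring
  obtain ⟨m, hm⟩ := exists_charSum_pow_ne_zero χ hN
  have hbound : ∀ m : ℕ, ‖charSum χ (fun x => x ^ (m + 1)) / ((m : ℂ) + 1)‖ ≤
      ∑ k ∈ Finset.Ico 1 N, ‖χ (k : ZMod N)‖ := fun m => by
    have h3 : ‖(m : ℂ) + 1‖ = m + 1 := by exact_mod_cast Complex.norm_natCast (m + 1)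
    rw [norm_div, h3]
    refine (div_le_self (norm_nonneg _) (by linarith [m.cast_nonneg (α := ℝ)])).trans ?_
    refine (norm_sum_le _ _).trans (Finset.sum_le_sum fun k hk => ?_)
    rw [norm_mul, norm_pow, norm_eq_one_of_mem_nontrivialRoots hN
      (zeta_pow_mem_nontrivialRoots hN hk), one_pow, mul_one]
  have h0 := lambert_coeff_eq_zero hbound (K := charSum χ (fun x => log (1 - x)) - b) (by
    filter_upwards [self_mem_nhdsWithin, mem_nhdsWithin_of_mem_nhds
      (Metric.ball_mem_nhds (0 : ℂ) one_pos)] with q hq0 hq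
    exact hlam q hq0 (mem_ball_zero_iff.1 hq)) m
  rcases div_eq_zero_iff.1 h0 with h3 | h3
  · exact hm h3
  · exact absurd h3 (by exact_mod_cast m.succ_ne_zero)

/-! ### The expansion of 𝔣, its Borel transform and its median sums. -/

section expansion

variable {N : ℕ} (χ : DirichletCharacter ℂ N)

/-- The coefficients of the positive powers in the asymptotic expansion of `𝔣`. -/
noncomputable def expansionCoeff (n : ℕ) : ℂ :=
  I / (2 * Real.pi) * charSum χ fun x => iteratedDeriv n (borelSeries x) 0 * (1 + (-1) ^ n)

/-- The asymptotic expansion of `𝔣`. -/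
noncomputable def expansion : LaurentSeries ℂ :=
  simplePoleSeries (-(I / (2 * Real.pi) * charSum χ dilogSeries))
    (1 / 2 * charSum χ fun x => log (1 - x)) (expansionCoeff χ)

/-- The Borel transform of the expansion of `𝔣`. -/
noncomputable def expansionBorel (ζ : ℂ) : ℂ :=
  I / (2 * Real.pi) * charSum χ fun x => borelSeries x ζ + borelSeries x (-ζ)

/-- The Laplace transform of `expansionBorel χ` along rays in the right half-plane. -/
noncomputable def expansionLaplace (y : ℂ) : ℂ :=
  I / (2 * Real.pi) * charSum χ fun x =>
    laplaceSeries x y - laplaceSeries x⁻¹ y - Real.pi ^ 2 / 6 * y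

variable {χ}

lemma slitDomain_radius_pos (hN : 2 ≤ N) : 0 < 2 * Real.pi / N := by
  have : (0 : ℝ) < N := by positivity
  have := Real.pi_pos
  positivity

lemma differentiableOn_borelSeries_root (hN : 2 ≤ N) {x : ℂ} (hx : x ∈ nontrivialRoots N) :
    DifferentiableOn ℂ (borelSeries x) (slitDomain (2 * Real.pi / N)) :=
  differentiableOn_borelSeries (slitDomain_radius_pos hN) fun _ hw =>
    exp_ne_of_mem_slitDomain (by omega) hx.1 hx.2 hw

lemma analyticAt_borelSeries (hN : 2 ≤ N) {x : ℂ} (hx : x ∈ nontrivialRoots N) :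
    AnalyticAt ℂ (borelSeries x) 0 :=
  (differentiableOn_borelSeries_root hN hx).analyticAt
    ((isOpen_slitDomain _).mem_nhds (zero_mem_slitDomain (slitDomain_radius_pos hN)))

lemma weightedF_eq_laplaceSeries (hN : 2 ≤ N) {y : ℂ} (hy : y.im ≠ 0) :
    weightedF χ y = -(I / (2 * Real.pi) * charSum χ dilogSeries) / y +
      1 / 2 * charSum χ (fun x => log (1 - x)) +
      I / (2 * Real.pi) * charSum χ fun x => laplaceSeries x y - laplaceSeries x (-y) := by
  rw [weightedF_eq_charSum χ hN, charSum_congr χ hN fun x hx =>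
    logQPochhammer_exp (norm_eq_one_of_mem_nontrivialRoots hN hx) hx.2 hy, charSum_add, charSum_sub,
    charSum_mul_left, charSum_mul_left]
  simp_rw [div_eq_mul_inv _ y]
  rw [charSum_mul_right, charSum_mul_left]
  ring

lemma exists_norm_weightedF_sub_le (hN : 2 ≤ N) (M : ℝ) (n : ℕ) :
    ∃ C : ℝ, ∀ y ∈ doubleSector M,
      ‖weightedF χ y - (-(I / (2 * Real.pi) * charSum χ dilogSeries) / y +
        1 / 2 * charSum χ (fun x => log (1 - x)) +
        ∑ j ∈ Finset.range n, expansionCoeff χ j * y ^ (j + 1))‖ ≤ C * ‖y‖ ^ (n + 1) := by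
  -- Membership in the root set is placed after the choice of C, so that `choose` yields a constant
  -- depending on x alone.
  have h : ∀ x : ℂ, ∃ C : ℝ, x ∈ nontrivialRoots N → ∀ y ∈ doubleSector M,
      ‖laplaceSeries x y - ∑ j ∈ Finset.range n, iteratedDeriv j (borelSeries x) 0 * y ^ (j + 1)‖ ≤
        C * ‖y‖ ^ (n + 1) := fun x => by
    by_cases hx : x ∈ nontrivialRoots N
    · obtain ⟨C, hC⟩ := exists_norm_laplaceSeries_sub_le_sector
        (norm_eq_one_of_mem_nontrivialRoots hN hx) hx.2 (analyticAt_borelSeries hN hx) M n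
      exact ⟨C, fun _ => hC⟩
    · exact ⟨0, fun h => absurd h hx⟩
  choose C hC using h
  refine ⟨‖I / (2 * Real.pi)‖ * ∑ k ∈ Finset.Ico 1 N, ‖χ (k : ZMod N)‖ *
    (2 * C (cexp (2 * Real.pi * I / N) ^ k)), fun y hy => ?_⟩
  set R : ℂ → ℂ → ℂ := fun x y =>
    laplaceSeries x y - ∑ j ∈ Finset.range n, iteratedDeriv j (borelSeries x) 0 * y ^ (j + 1)
  have hsum : ∑ j ∈ Finset.range n, expansionCoeff χ j * y ^ (j + 1) = I / (2 * Real.pi) *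
      charSum χ fun x => ∑ j ∈ Finset.range n,
        iteratedDeriv j (borelSeries x) 0 * (1 + (-1) ^ j) * y ^ (j + 1) := by
    simp only [expansionCoeff, charSum, Finset.mul_sum, Finset.sum_mul]
    rw [Finset.sum_comm]
    refine Finset.sum_congr rfl fun k _ => Finset.sum_congr rfl fun j _ => ?_
    ring
  have e : weightedF χ y - (-(I / (2 * Real.pi) * charSum χ dilogSeries) / y +
        1 / 2 * charSum χ (fun x => log (1 - x)) +
        ∑ j ∈ Finset.range n, expansionCoeff χ j * y ^ (j + 1)) =
      I / (2 * Real.pi) * charSum χ fun x => R x y - R x (-y) := by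
    rw [weightedF_eq_laplaceSeries hN hy.1, hsum, add_sub_add_left_eq_sub, ← mul_sub, ← charSum_sub]
    congr 2
    funext x
    simp only [R]
    rw [sub_sub_sub_comm, ← Finset.sum_sub_distrib]
    congr 1
    refine Finset.sum_congr rfl fun j _ => ?_
    -- The coefficient of y^(j+1) in the expansion of L_x(-y) has sign (-1)^(j+1); subtracting it
    -- produces the factor 1 + (-1)^j.
    rw [neg_pow y (j + 1), pow_succ (-1 : ℂ) j]
    ring
  rw [e, norm_mul, mul_assoc]
  refine mul_le_mul_of_nonneg_left ?_ (norm_nonneg (I / (2 * Real.pi)))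
  rw [charSum, Finset.sum_mul]
  refine norm_sum_le_of_le _ fun k hk => ?_
  have hx := zeta_pow_mem_nontrivialRoots hN hk
  rw [norm_mul, mul_assoc ‖χ (k : ZMod N)‖]
  refine mul_le_mul_of_nonneg_left ?_ (norm_nonneg (χ (k : ZMod N)))
  have h1 := hC _ hx y hy
  have h2 := hC _ hx (-y) (neg_mem_doubleSector hy)
  rw [norm_neg y] at h2
  refine (norm_sub_le _ _).trans ?_
  linarith

lemma hasAsymptoticExpansionUpper_expansion (hN : 2 ≤ N) :
    HasAsymptoticExpansionUpper (weightedF χ) (expansion χ) := fun M => by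
  refine hasAsymptoticExpansionWithin_simplePoleSeries _ _ _ (by simp) fun n => ?_
  obtain ⟨C, hC⟩ := exists_norm_weightedF_sub_le (χ := χ) hN M n
  exact ⟨C, fun y hy => hC y ⟨hy.1.ne', by rw [abs_of_pos hy.1]; exact hy.2⟩⟩

lemma hasAsymptoticExpansionLower_expansion (hN : 2 ≤ N) :
    HasAsymptoticExpansionLower (weightedF χ) (expansion χ) := fun M => by
  refine hasAsymptoticExpansionWithin_simplePoleSeries _ _ _ (by simp) fun n => ?_
  obtain ⟨C, hC⟩ := exists_norm_weightedF_sub_le (χ := χ) hN M n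
  exact ⟨C, fun y hy => hC y ⟨hy.1.ne, by rw [abs_of_neg hy.1]; exact hy.2⟩⟩

lemma isBorelContinuation_expansionBorel (hN : 2 ≤ N) :
    IsBorelContinuation (expansionCoeff χ) (slitDomain (2 * Real.pi / N)) (expansionBorel χ) where
  isOpen := isOpen_slitDomain _
  starConvex := starConvex_slitDomain (slitDomain_radius_pos hN)
  differentiableOn := by
    refine DifferentiableOn.const_mul (DifferentiableOn.fun_sum fun k hk => ?_) _
    have h := differentiableOn_borelSeries_root hN (zeta_pow_mem_nontrivialRoots hN hk)
    exact (h.add (h.comp (differentiableOn_neg _) fun w hw => neg_mem_slitDomain hw)).const_mul _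
  hasSum := by
    obtain ⟨r, hr, hball⟩ := Metric.isOpen_iff.1 (isOpen_slitDomain (2 * Real.pi / N)) 0
      (zero_mem_slitDomain (slitDomain_radius_pos hN))
    filter_upwards [Metric.ball_mem_nhds (0 : ℂ) hr] with ζ hζ
    have hζ' : -ζ ∈ Metric.ball (0 : ℂ) r := by simpa using hζ
    have h : ∀ k ∈ Finset.Ico 1 N, HasSum (fun n : ℕ => χ (k : ZMod N) *
        (iteratedDeriv n (borelSeries (cexp (2 * Real.pi * I / N) ^ k)) 0 * (1 + (-1) ^ n) /
          (n.factorial : ℂ) * ζ ^ n))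
        (χ (k : ZMod N) * (borelSeries (cexp (2 * Real.pi * I / N) ^ k) ζ +
          borelSeries (cexp (2 * Real.pi * I / N) ^ k) (-ζ))) := fun k hk => by
      have hd := (differentiableOn_borelSeries_root hN
        (zeta_pow_mem_nontrivialRoots hN hk)).mono hball
      refine HasSum.mul_left _ (((Complex.hasSum_taylorSeries_on_ball hd hζ).add
        (Complex.hasSum_taylorSeries_on_ball hd hζ')).congr_fun fun n => ?_)
      simp only [sub_zero, smul_eq_mul]
      rw [neg_pow ζ n]
      ring
    refine ((hasSum_sum h).mul_left (I / (2 * Real.pi))).congr_fun fun n => ?_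
    simp only [expansionCoeff, charSum, Finset.mul_sum, Finset.sum_div, Finset.sum_mul]
    refine Finset.sum_congr rfl fun k _ => ?_
    ring

lemma expansionBorel_neg (ζ : ℂ) : expansionBorel χ (-ζ) = expansionBorel χ ζ := by
  simp only [expansionBorel, neg_neg, add_comm]

/-- The reflection `borelSeries_neg_ray` brings the values at -ζ back to the right half-plane, where
the Laplace transform is known. The constant π²/6 integrates to a multiple of y. -/
lemma laplace_borelSeries_add_neg {x u y : ℂ} (hx : ‖x‖ = 1) (hx1 : x ≠ 1) (hu : 0 < u.re)
    (huy : 0 < (u / y).re) :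
    IntegrableOn (fun t : ℝ => cexp (-(t * u) / y) *
      (borelSeries x (t * u) + borelSeries x (-(t * u))) * u) (Set.Ioi 0) ∧
    ∫ t : ℝ in Set.Ioi 0, cexp (-(t * u) / y) *
      (borelSeries x (t * u) + borelSeries x (-(t * u))) * u =
      laplaceSeries x y - laplaceSeries x⁻¹ y - Real.pi ^ 2 / 6 * y := by
  have hi : ‖x⁻¹‖ = 1 := by simp [hx]
  have hi1 : x⁻¹ ≠ 1 := by simpa using hx1
  have hu0 : u ≠ 0 := by rintro rfl; simp at hu
  have i1 := integrableOn_laplace_borelSeries hx hx1 hu huy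
  have i2 := integrableOn_laplace_borelSeries hi hi1 hu huy
  have i12 : IntegrableOn (fun t : ℝ => cexp (-(t * u) / y) * borelSeries x (t * u) * u -
      cexp (-(t * u) / y) * borelSeries x⁻¹ (t * u) * u) (Set.Ioi 0) := i1.sub i2
  have i3 : IntegrableOn (fun t : ℝ => Real.pi ^ 2 / 6 * u * cexp (-(u / y * t))) (Set.Ioi 0) :=
    (integrableOn_exp_neg_mul huy).const_mul _
  have e : ∀ t ∈ Set.Ioi (0 : ℝ), cexp (-(t * u) / y) * borelSeries x (t * u) * u -
      cexp (-(t * u) / y) * borelSeries x⁻¹ (t * u) * u -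
      Real.pi ^ 2 / 6 * u * cexp (-(u / y * t)) = cexp (-(t * u) / y) *
      (borelSeries x (t * u) + borelSeries x (-(t * u))) * u := fun t ht => by
    rw [borelSeries_neg_ray hx hx1 hu (le_of_lt ht), show -(u / y * t) = -(t * u) / y by ring]
    ring
  refine ⟨IntegrableOn.congr_fun (i12.sub i3) e measurableSet_Ioi, ?_⟩
  rw [← setIntegral_congr_fun measurableSet_Ioi e, integral_sub i12 i3, integral_sub i1 i2,
    laplace_borelSeries hx hx1 hu huy, laplace_borelSeries hi hi1 hu huy, integral_const_mul,
    integral_exp_neg_mul huy]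
  congr 1
  field_simp

lemma laplace_expansionBorel (hN : 2 ≤ N) {u y : ℂ} (hu : 0 < u.re) (huy : 0 < (u / y).re) :
    IntegrableOn (fun t : ℝ => cexp (-(t * u) / y) * expansionBorel χ (t * u) * u) (Set.Ioi 0) ∧
    ∫ t : ℝ in Set.Ioi 0, cexp (-(t * u) / y) * expansionBorel χ (t * u) * u =
      expansionLaplace χ y := by
  have h : ∀ k ∈ Finset.Ico 1 N, _ := fun k hk =>
    laplace_borelSeries_add_neg (norm_eq_one_of_mem_nontrivialRoots hN
      (zeta_pow_mem_nontrivialRoots hN hk)) (zeta_pow_mem_nontrivialRoots hN hk).2 hu huy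
  have e : (fun t : ℝ => cexp (-(t * u) / y) * expansionBorel χ (t * u) * u) = fun t : ℝ =>
      I / (2 * Real.pi) * ∑ k ∈ Finset.Ico 1 N, χ (k : ZMod N) * (cexp (-(t * u) / y) *
        (borelSeries (cexp (2 * Real.pi * I / N) ^ k) (t * u) +
          borelSeries (cexp (2 * Real.pi * I / N) ^ k) (-(t * u))) * u) := by
    funext t
    simp only [expansionBorel, charSum, Finset.mul_sum, Finset.sum_mul]
    refine Finset.sum_congr rfl fun k _ => ?_
    ring
  have hint : ∀ k ∈ Finset.Ico 1 N, Integrable (fun t : ℝ => χ (k : ZMod N) *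
      (cexp (-(t * u) / y) * (borelSeries (cexp (2 * Real.pi * I / N) ^ k) (t * u) +
        borelSeries (cexp (2 * Real.pi * I / N) ^ k) (-(t * u))) * u))
      (volume.restrict (Set.Ioi 0)) := fun k hk => (h k hk).1.const_mul _
  rw [e]
  refine ⟨(integrable_finsetSum _ hint).const_mul _, ?_⟩
  rw [integral_const_mul, integral_finsetSum _ hint, expansionLaplace, charSum]
  congr 1
  refine Finset.sum_congr rfl fun k hk => ?_
  rw [integral_const_mul, (h k hk).2]

lemma exp_div_eq_inv (θ : ℝ) (y : ℂ) : cexp (θ * I) / y = (cexp (-(θ * I)) * y)⁻¹ := by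
  rw [mul_inv, ← Complex.exp_neg, neg_neg, div_eq_mul_inv]

lemma re_inv_pos {w : ℂ} (hw : 0 < w.re) : 0 < (w⁻¹).re := by
  rw [inv_re]
  exact div_pos hw (normSq_pos.2 fun h => by simp [h] at hw)

lemma hasLaplaceSum_of_cos_pos (hN : 2 ≤ N) {θ : ℝ} {y : ℂ} (hθ : 0 < Real.cos θ)
    (hy : 0 < (cexp (-(θ * I)) * y).re) :
    HasLaplaceSum (expansionCoeff χ) θ y (expansionLaplace χ y) := by
  have hu : 0 < (cexp (θ * I)).re := by rwa [exp_ofReal_mul_I_re]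
  have huy : 0 < (cexp (θ * I) / y).re := by rw [exp_div_eq_inv]; exact re_inv_pos hy
  obtain ⟨h1, h2⟩ := laplace_expansionBorel (χ := χ) hN hu huy
  exact ⟨hy, _, _, isBorelContinuation_expansionBorel hN,
    fun t _ => ray_mem_slitDomain (slitDomain_radius_pos hN) hu.ne' t, h1, h2⟩

/-- The Borel transform is even, so a ray on the left for y is the opposite ray on the right for -y,
with reversed sign of dζ. -/
lemma hasLaplaceSum_of_cos_neg (hN : 2 ≤ N) {θ : ℝ} {y : ℂ} (hθ : Real.cos θ < 0)
    (hy : 0 < (cexp (-(θ * I)) * y).re) :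
    HasLaplaceSum (expansionCoeff χ) θ y (-expansionLaplace χ (-y)) := by
  have hu : (cexp (θ * I)).re < 0 := by rwa [exp_ofReal_mul_I_re]
  have hu' : 0 < (-cexp (θ * I)).re := by simpa using hu
  have huy : 0 < (-cexp (θ * I) / -y).re := by
    rw [neg_div_neg_eq, exp_div_eq_inv]; exact re_inv_pos hy
  obtain ⟨h1, h2⟩ := laplace_expansionBorel (χ := χ) hN hu' huy
  have e : (fun t : ℝ => cexp (-(t * cexp (θ * I)) / y) * expansionBorel χ (t * cexp (θ * I)) *
      cexp (θ * I)) = fun t : ℝ => -(cexp (-(t * -cexp (θ * I)) / -y) *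
        expansionBorel χ (t * -cexp (θ * I)) * -cexp (θ * I)) := by
    funext t
    rw [mul_neg (t : ℂ), neg_neg, expansionBorel_neg, div_neg, ← neg_div]
    ring
  refine ⟨hy, _, expansionBorel χ, isBorelContinuation_expansionBorel hN,
    fun t _ => ray_mem_slitDomain (slitDomain_radius_pos hN) hu.ne t, ?_, ?_⟩
  · rw [e]; exact h1.neg
  · rw [e, integral_neg, h2]

lemma hasBorelLaplaceSum_expansion {θ : ℝ} {y v : ℂ}
    (h : HasLaplaceSum (expansionCoeff χ) θ y v) :
    HasBorelLaplaceSum (expansion χ) θ y (-(I / (2 * Real.pi) * charSum χ dilogSeries) / y +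
      1 / 2 * charSum χ (fun x => log (1 - x)) + v) := by
  have hc : (fun n : ℕ => (expansion χ).coeff ((n : ℤ) + 1)) = expansionCoeff χ :=
    funext fun n => simplePoleSeries_coeff_succ _ _ _ n
  rw [HasBorelLaplaceSum, hc, expansion, simplePoleSeries_sum_Icc, add_sub_cancel_left]
  exact h

variable (χ) in
/-- The value of the median resummations of the expansion of `𝔣`. -/
noncomputable def medianValue (y : ℂ) : ℂ :=
  -(I / (2 * Real.pi) * charSum χ dilogSeries) / y + 1 / 2 * charSum χ (fun x => log (1 - x)) +
    (expansionLaplace χ y - expansionLaplace χ (-y)) / 2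

lemma eventually_re_exp_mul_pos {θ : ℝ} {y : ℂ} (h : 0 < (cexp (-(θ * I)) * y).re) :
    (∀ᶠ ε in 𝓝[>] (0 : ℝ), 0 < (cexp (-((θ + ε : ℝ) * I)) * y).re) ∧
    ∀ᶠ ε in 𝓝[>] (0 : ℝ), 0 < (cexp (-((θ - ε : ℝ) * I)) * y).re := by
  have h1 : Continuous fun ε : ℝ => (cexp (-((θ + ε : ℝ) * I)) * y).re := by fun_prop
  have h2 : Continuous fun ε : ℝ => (cexp (-((θ - ε : ℝ) * I)) * y).re := by fun_prop
  exact ⟨(h1.continuousAt.eventually (lt_mem_nhds (by simpa using h))).filter_mono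
      nhdsWithin_le_nhds,
    (h2.continuousAt.eventually (lt_mem_nhds (by simpa using h))).filter_mono nhdsWithin_le_nhds⟩

/-- For 0 < ε < π the ray at π/2 + ε lies to the left of the imaginary axis and the one at π/2 - ε
to the right. Only the convergence condition makes the admissible ε depend on y. -/
lemma hasMedianSum_upper (hN : 2 ≤ N) {y : ℂ} (hy : 0 < y.im) :
    HasMedianSum (expansion χ) (Real.pi / 2) y (medianValue χ y) := by
  have h0 : 0 < (cexp (-((Real.pi / 2 : ℝ) * I)) * y).re := by
    rw [← neg_mul, ← ofReal_neg, ofReal_neg, ofReal_div, ofReal_ofNat, Complex.exp_mul_I]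
    simpa [Complex.cos_neg, Complex.sin_neg] using hy
  obtain ⟨h1, h2⟩ := eventually_re_exp_mul_pos h0
  refine ⟨(-(I / (2 * Real.pi) * charSum χ dilogSeries) / y +
      1 / 2 * charSum χ (fun x => log (1 - x)) + -expansionLaplace χ (-y)),
    (-(I / (2 * Real.pi) * charSum χ dilogSeries) / y +
      1 / 2 * charSum χ (fun x => log (1 - x)) + expansionLaplace χ y), ?_, ?_, ?_⟩
  · filter_upwards [h1, Ioo_mem_nhdsGT Real.pi_pos] with ε hε hmem
    refine hasBorelLaplaceSum_expansion (hasLaplaceSum_of_cos_neg hN ?_ hε)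
    rw [add_comm, Real.cos_add_pi_div_two]
    simpa using Real.sin_pos_of_pos_of_lt_pi hmem.1 hmem.2
  · filter_upwards [h2, Ioo_mem_nhdsGT Real.pi_pos] with ε hε hmem
    refine hasBorelLaplaceSum_expansion (hasLaplaceSum_of_cos_pos hN ?_ hε)
    rw [Real.cos_pi_div_two_sub]
    exact Real.sin_pos_of_pos_of_lt_pi hmem.1 hmem.2
  · rw [medianValue]; ring

/-- At -π/2 the two lateral sums trade places, which leaves their average unchanged. -/
lemma hasMedianSum_lower (hN : 2 ≤ N) {y : ℂ} (hy : y.im < 0) :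
    HasMedianSum (expansion χ) (-(Real.pi / 2)) y (medianValue χ y) := by
  have h0 : 0 < (cexp (-((-(Real.pi / 2) : ℝ) * I)) * y).re := by
    rw [← neg_mul, ← ofReal_neg, neg_neg, ofReal_div, ofReal_ofNat, Complex.exp_mul_I]
    simpa using hy
  obtain ⟨h1, h2⟩ := eventually_re_exp_mul_pos h0
  refine ⟨(-(I / (2 * Real.pi) * charSum χ dilogSeries) / y +
      1 / 2 * charSum χ (fun x => log (1 - x)) + expansionLaplace χ y),
    (-(I / (2 * Real.pi) * charSum χ dilogSeries) / y +
      1 / 2 * charSum χ (fun x => log (1 - x)) + -expansionLaplace χ (-y)), ?_, ?_, ?_⟩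
  · filter_upwards [h1, Ioo_mem_nhdsGT Real.pi_pos] with ε hε hmem
    refine hasBorelLaplaceSum_expansion (hasLaplaceSum_of_cos_pos hN ?_ hε)
    rw [add_comm, ← sub_eq_add_neg, Real.cos_sub_pi_div_two]
    exact Real.sin_pos_of_pos_of_lt_pi hmem.1 hmem.2
  · filter_upwards [h2, Ioo_mem_nhdsGT Real.pi_pos] with ε hε hmem
    refine hasBorelLaplaceSum_expansion (hasLaplaceSum_of_cos_neg hN ?_ hε)
    rw [← neg_add', Real.cos_neg, add_comm, Real.cos_add_pi_div_two]
    simpa using Real.sin_pos_of_pos_of_lt_pi hmem.1 hmem.2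
  · rw [medianValue]; ring

/-- By `charSum_inv` the terms with x⁻¹ equal χ(-1) times those with x; this makes the dependence on
parity explicit. -/
lemma expansionLaplace_sub_neg (y : ℂ) :
    (expansionLaplace χ y - expansionLaplace χ (-y)) / 2 = I / (2 * Real.pi) *
      ((1 - χ (-1)) / 2 * charSum χ (fun x => laplaceSeries x y - laplaceSeries x (-y)) -
        charSum χ (fun _ => 1) * (Real.pi ^ 2 / 6 * y)) := by
  have h : ∀ y : ℂ, expansionLaplace χ y = I / (2 * Real.pi) *
      ((1 - χ (-1)) * charSum χ (fun x => laplaceSeries x y) -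
        charSum χ (fun _ => 1) * (Real.pi ^ 2 / 6 * y)) := fun y => by
    have h1 := charSum_mul_right χ (fun _ => 1) (Real.pi ^ 2 / 6 * y)
    simp only [one_mul] at h1
    rw [expansionLaplace, charSum_sub, charSum_sub, charSum_inv χ fun x => laplaceSeries x y, h1]
    ring
  rw [h, h, charSum_sub]
  ring

lemma medianValue_eq_of_odd (hN : 2 ≤ N) (hχ : χ.Odd) {y : ℂ} (hy : y.im ≠ 0) :
    medianValue χ y = weightedF χ y := by
  have h1 : χ (-1) = -1 := hχ
  -- Applied to a constant, the inversion x ↦ x⁻¹ shows that this sum equals its own negative.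
  have h0 : charSum χ (fun _ => 1) = 0 := by
    have h := charSum_inv χ (fun _ => 1)
    rw [h1] at h
    linear_combination h / 2
  rw [medianValue, expansionLaplace_sub_neg, weightedF_eq_laplaceSeries hN hy, h1, h0]
  ring

lemma medianValue_eq_of_even (hχ : χ.Even) (y : ℂ) :
    medianValue χ y = -(I / (2 * Real.pi) * charSum χ dilogSeries) / y +
      1 / 2 * charSum χ (fun x => log (1 - x)) +
      -(I / (2 * Real.pi) * charSum χ (fun _ => 1) * (Real.pi ^ 2 / 6)) * y := by
  have h1 : χ (-1) = 1 := hχ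
  rw [medianValue, expansionLaplace_sub_neg, h1]
  ring

/-- Everything in the formula for 𝔣 is odd in y except the constant. This transfers the
non-polynomiality from the upper to the lower half-plane. -/
lemma weightedF_neg (hN : 2 ≤ N) {y : ℂ} (hy : y.im ≠ 0) :
    weightedF χ (-y) = charSum χ (fun x => log (1 - x)) - weightedF χ y := by
  have hy' : (-y).im ≠ 0 := by simpa using hy
  rw [weightedF_eq_laplaceSeries hN hy, weightedF_eq_laplaceSeries hN hy', neg_neg, charSum_sub,
    charSum_sub, div_neg]
  ring

end expansion

theorem theorem1p4 (N : ℕ) (hN : 2 ≤ N) (χ : DirichletCharacter ℂ N) :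
    ∃ φ : LaurentSeries ℂ,
      -- `φ` is the unique asymptotic expansion of `𝔣` as `y → 0`, from above and from below
      (∀ φ' : LaurentSeries ℂ, HasAsymptoticExpansionUpper (weightedF χ) φ' ↔ φ' = φ) ∧
      (∀ φ' : LaurentSeries ℂ, HasAsymptoticExpansionLower (weightedF χ) φ' ↔ φ' = φ) ∧
      -- its median resummations at the angles `π/2` and `-π/2` exist
      (∀ y : ℂ, 0 < y.im → ∃ v : ℂ, HasMedianSum φ (Real.pi / 2) y v) ∧
      (∀ y : ℂ, y.im < 0 → ∃ v : ℂ, HasMedianSum φ (-(Real.pi / 2)) y v) ∧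
      -- they agree with `𝔣` if and only if `χ` is odd
      ((∀ y : ℂ, 0 < y.im → HasMedianSum φ (Real.pi / 2) y (weightedF χ y)) ↔ χ.Odd) ∧
      ((∀ y : ℂ, y.im < 0 → HasMedianSum φ (-(Real.pi / 2)) y (weightedF χ y)) ↔ χ.Odd) := by
  have hU := hasAsymptoticExpansionUpper_expansion (χ := χ) hN
  have hL := hasAsymptoticExpansionLower_expansion (χ := χ) hN
  refine ⟨expansion χ, fun φ' => ⟨fun h => h.unique hU, fun h => h ▸ hU⟩,
    fun φ' => ⟨fun h => h.unique hL, fun h => h ▸ hL⟩,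
    fun y hy => ⟨_, hasMedianSum_upper hN hy⟩, fun y hy => ⟨_, hasMedianSum_lower hN hy⟩,
    ⟨fun h => ?_, fun hχ y hy => ?_⟩, ⟨fun h => ?_, fun hχ y hy => ?_⟩⟩
  · refine χ.even_or_odd.resolve_left fun hχ => ?_
    exact weightedF_ne_laurent_polynomial hN χ _ _ _ fun y hy =>
      ((h y hy).unique (hasMedianSum_upper hN hy)).trans (medianValue_eq_of_even hχ y)
  · rw [← medianValue_eq_of_odd hN hχ hy.ne']
    exact hasMedianSum_upper hN hy
  · refine χ.even_or_odd.resolve_left fun hχ => ?_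
    -- Replacing y by -y and subtracting from twice the constant term reproduces the same Laurent
    -- polynomial, so the coefficients are those of `medianValue_eq_of_even`.
    refine weightedF_ne_laurent_polynomial hN χ (-(I / (2 * Real.pi) * charSum χ dilogSeries))
      (1 / 2 * charSum χ (fun x => log (1 - x)))
      (-(I / (2 * Real.pi) * charSum χ (fun _ => 1) * (Real.pi ^ 2 / 6))) fun y hy => ?_
    have hy' : (-y).im < 0 := by simpa using hy
    have h1 := weightedF_neg (χ := χ) hN hy.ne'
    rw [(h (-y) hy').unique (hasMedianSum_lower hN hy'), medianValue_eq_of_even hχ, div_neg] at h1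
    linear_combination h1
  · rw [← medianValue_eq_of_odd hN hχ hy.ne]
    exact hasMedianSum_lower hN hy
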